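/- Let $R$ be a commutative ring and $G$ a finite abelian group. All rings are commutative with $1$. A unital partial action $\alpha=(S_g,\alpha_g)_{g\in G}$ of a group $G$ on an $R$-algebra $S$ consists of ideals $S_g=S1_g$ of $S$ with $1_g$ idempotent, and of $R$-algebra isomorphisms $\alpha_g:S_{g^{-1}}\to S_g$, such that $S_1=S$, $\alpha_1=\mathrm{id}_S$, $\alpha_g(S_{g^{-1}}\cap S_h)=S_g\cap S_{gh}$, and $\alpha_g(\alpha_h(x))=\alpha_{gh}(x)$ for $x\in S_{h^{-1}}\cap S_{(gh)^{-1}}$. Its invariants are $S^\alpha=\{s\in S:\alpha_g(s1_{g^{-1}})=s1_g\ \text{for all } g\in G\}$, and $\alpha_H=(S_h,\alpha_h)_{h\in H}$ is its restriction to a subgroup $H$. The pair $(S,\alpha)$ is a partial Galois extension of $R$ with group $G$ if $R\subseteq S$, $S^\alpha=R$, and there are $x_1,\dots,x_m,y_1,\dots,y_m\in S$ with $\sum_i x_i\alpha_g(y_i1_{g^{-1}})=\delta_{1,g}$ for all $g\in G$. Two such pairs $(S,\alpha)$, $(S',\alpha')$ are partially $G$-isomorphic if there is an $R$-algebra isomorphism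 $f:S\to S'$ with $f(S_g)\subseteq S'_g$ and $f\circ\alpha_g=\alpha'_g\circ f$ on $S_{g^{-1}}$ for all $g\in G$; this is an equivalence relation. Let $\mathcal H_{par}(G,R)$ be the set of equivalence classes $[S,\alpha]$. A globalization of a unital partial action $\alpha$ of a finite group is a global action $\beta$ on an algebra $T$ that contains $S$ as an ideal, with $S_g=S\cap\beta_g(S)$, $\beta_g|_{S_{g^{-1}}}=\alpha_g$ and $T=\sum_g\beta_g(S)$. For a normal subgroup $H=\{h_1=1,h_2,\dots,h_m\}$ put $\psi_H(t)=\sum_{i=1}^m\beta_{h_i}(t)\,\Big(\prod_{j<i}(1_T-\beta_{h_j}(1_S))\Big)\beta_{h_i}(1_S)$ for $t\in T$, and $e_H=\psi_H(1_S)$. The induced partial action $\alpha_{G/H}$ of $G/H$ on $S^{\alpha_H}$ has ideals $\tilde D_{gH}=S^{\alpha_H}\tilde 1_{gH}$ with $\tilde 1_{gH}=e_H\beta_g(e_H)1_S$, and isomorphisms $\alpha_{gH}:\tilde D_{g^{-1}H}\to\tilde D_{gH}$, $x\mapsto\beta_g(\psi_H(x))1_S$. Let $\delta G=\{(g,g^{-1}):g\in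 G\}\subseteq G\times G$, and identify $G$ with $(G\times G)/\delta G$ through $g\mapsto(g,1)\delta G$. For partial Galois extensions $(S,\alpha)$, $(S',\alpha')$ of $R$ with group $G$ let $\alpha\otimes\alpha'$ be the partial action of $G\times G$ on $S\otimes_RS'$ with ideals $S_g\otimes S'_h$ and isomorphisms $\alpha_g\otimes\alpha'_h$. Then $\big((S\otimes_R S')^{(\alpha\otimes\alpha')_{\delta G}},\,(\alpha\otimes\alpha')_{(G\times G)/\delta G}\big)$ is a well-defined partial Galois extension of $R$ with group $G$ (independent of the globalization and of the enumeration of $\delta G$); its class depends only on $[S,\alpha]$ and $[S',\alpha']$; and with the product $$[S,\alpha]*_{par}[S',\alpha']=\big[(S\otimes_R S')^{(\alpha\otimes\alpha')_{\delta G}},\ (\alpha\otimes\alpha')_{(G\times G)/\delta G}\big]$$ the set $\mathcal H_{par}(G,R)$ is a commutative semigroup. -/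

import Mathlib

open scoped TensorProduct

universe u v w

/-- A partial action `α = (S_g, α_g)` of a group `G` on a commutative `k`-algebra `S`. -/
structure PartialAction (k : Type*) (G : Type*) (S : Type*) [CommRing k] [Group G] [CommRing S]
    [Algebra k S] where
  /-- the ideal `S_g` -/
  ideal : G → Ideal S
  /-- the isomorphism `α_g : S_{g⁻¹} → S_g` -/
  map : ∀ g : G, ideal g⁻¹ ≃ₗ[k] ideal g
  /-- `α_g` is multiplicative -/
  map_mul : ∀ (g : G) (x y : ideal g⁻¹), (map g ((x : S) • y) : S) = map g x * map g y
  /-- `S_1 = S` -/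
  ideal_one : ideal 1 = ⊤
  /-- `α_1 = id` -/
  map_one : ∀ x : ideal (1 : G)⁻¹, (map 1 x : S) = x
  /-- `α_g (S_{g⁻¹} ∩ S_h) = S_g ∩ S_{gh}` -/
  map_inter : ∀ g h : G,
    {s : S | ∃ x : ideal g⁻¹, (x : S) ∈ ideal h ∧ (map g x : S) = s} = ↑(ideal g ⊓ ideal (g * h))
  /-- `α_g (α_h x) = α_{gh} x` for `x ∈ S_{h⁻¹} ∩ S_{(gh)⁻¹}`; then `α_h x ∈ S_{g⁻¹}` -/
  map_map : ∀ (g h : G) (x : ideal h⁻¹) (y : ideal g⁻¹) (z : ideal (g * h)⁻¹),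
    (z : S) = x → (y : S) = map h x → (map g y : S) = map (g * h) z

/-- A unital partial action: each `S_g` is generated by an idempotent `1_g` (which is unique). -/
structure UnitalPartialAction (k : Type*) (G : Type*) (S : Type*) [CommRing k] [Group G]
    [CommRing S] [Algebra k S] extends PartialAction k G S where
  /-- the identity element `1_g` of `S_g` -/
  one : G → S
  one_idem : ∀ g, one g * one g = one g
  ideal_eq : ∀ g, ideal g = Ideal.span {one g}

namespace UnitalPartialAction

section

variable {k G S : Type*} [CommRing k] [Group G] [CommRing S] [Algebra k S]

theorem mem_ideal (α : UnitalPartialAction k G S) {g : G} {x : S} :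
    x ∈ α.ideal g ↔ x * α.one g = x := by
  rw [α.ideal_eq, Ideal.mem_span_singleton']
  constructor
  · rintro ⟨a, rfl⟩
    rw [mul_assoc, α.one_idem]
  · intro h
    exact ⟨x, h⟩

theorem mul_one_mem (α : UnitalPartialAction k G S) (g : G) (s : S) :
    s * α.one g ∈ α.ideal g := by
  rw [mem_ideal, mul_assoc, α.one_idem]

/-- The `k`-linear map `S → S`, `s ↦ α_g (s 1_{g⁻¹})`. -/
def act (α : UnitalPartialAction k G S) (g : G) : S →ₗ[k] S where
  toFun s := α.map g ⟨s * α.one g⁻¹, α.mul_one_mem g⁻¹ s⟩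
  map_add' s t := by
    rw [← Submodule.coe_add, ← map_add]
    congr 2
    exact Subtype.ext (add_mul s t _)
  map_smul' c s := by
    rw [RingHom.id_apply, ← Submodule.coe_smul_of_tower, ← map_smul]
    congr 2
    exact Subtype.ext (smul_mul_assoc c s _)

theorem act_def (α : UnitalPartialAction k G S) (g : G) (s : S) :
    α.act g s = α.map g ⟨s * α.one g⁻¹, α.mul_one_mem g⁻¹ s⟩ := rfl

theorem act_coe (α : UnitalPartialAction k G S) (g : G) (x : α.ideal g⁻¹) :
    α.act g x = α.map g x := by
  rw [act_def]
  congr 2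
  exact Subtype.ext (α.mem_ideal.1 x.2)

theorem act_mul (α : UnitalPartialAction k G S) (g : G) (s t : S) :
    α.act g (s * t) = α.act g s * α.act g t := by
  rw [act_def, act_def, act_def, ← α.map_mul]
  congr 2
  apply Subtype.ext
  change s * t * α.one g⁻¹ = s * α.one g⁻¹ * (t * α.one g⁻¹)
  linear_combination (-(s * t)) * α.one_idem g⁻¹

theorem act_mem (α : UnitalPartialAction k G S) (g : G) (s : S) :
    α.act g s * α.one g = α.act g s :=
  α.mem_ideal.1 (α.map g _).2

theorem one_one (α : UnitalPartialAction k G S) : α.one 1 = 1 := by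
  have h : (1 : S) ∈ α.ideal 1 := by rw [α.ideal_one]; trivial
  simpa using α.mem_ideal.1 h

theorem act_one (α : UnitalPartialAction k G S) (g : G) : α.act g 1 = α.one g := by
  have h1 : α.one g ∈ α.ideal g := by rw [mem_ideal, α.one_idem]
  obtain ⟨x, hx⟩ := (α.map g).surjective ⟨α.one g, h1⟩
  have h2 : α.act g x = α.one g := by rw [act_coe, hx]
  have h3 : α.act g (x * 1) = α.act g x * α.act g 1 := α.act_mul g x 1
  rw [mul_one, h2, mul_comm, act_mem] at h3
  exact h3.symm

theorem act_one_apply (α : UnitalPartialAction k G S) (s : S) : α.act 1 s = s := by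
  rw [act_def, α.map_one]
  simp [α.one_one]

theorem act_one_inv (α : UnitalPartialAction k G S) (g : G) :
    α.act g (α.one g⁻¹) = α.one g := by
  rw [← α.act_one g, act_def, act_def]
  congr 2
  apply Subtype.ext
  change α.one g⁻¹ * α.one g⁻¹ = 1 * α.one g⁻¹
  rw [α.one_idem, one_mul]

theorem act_one_mul (α : UnitalPartialAction k G S) (g h : G) :
    α.act g (α.one h) = α.one g * α.one (g * h) := by
  have hin := α.map_inter g h
  have h1 : α.act g (α.one h) ∈ α.ideal g ⊓ α.ideal (g * h) := by
    rw [← SetLike.mem_coe, ← hin]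
    refine ⟨⟨α.one h * α.one g⁻¹, α.mul_one_mem _ _⟩, ?_, rfl⟩
    exact (α.ideal h).mul_mem_right _ (α.mem_ideal.2 (α.one_idem h))
  have h2 : α.one g * α.one (g * h) ∈ α.ideal g ⊓ α.ideal (g * h) :=
    ⟨(α.ideal g).mul_mem_right _ (α.mem_ideal.2 (α.one_idem g)), α.mul_one_mem _ _⟩
  rw [← SetLike.mem_coe, ← hin] at h2
  obtain ⟨x, hx, hx'⟩ := h2
  have h3 : α.act g (x * α.one h) = α.act g x * α.act g (α.one h) := α.act_mul _ _ _
  rw [α.mem_ideal.1 hx, act_coe, hx'] at h3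
  have h4 := α.mem_ideal.1 h1.1
  have h5 := α.mem_ideal.1 h1.2
  rw [h3]
  linear_combination (-α.one (g * h)) * h4 - h5

theorem act_act (α : UnitalPartialAction k G S) (g h : G) (s : S) :
    α.act g (α.act h s) = α.act (g * h) s * α.one g := by
  have hm : s * α.one h⁻¹ * α.one (g * h)⁻¹ ∈ α.ideal h⁻¹ :=
    (α.ideal _).mul_mem_right _ (α.mul_one_mem _ _)
  have h1 : α.act h (s * α.one h⁻¹ * α.one (g * h)⁻¹) = α.act h s * α.one g⁻¹ := by
    rw [act_mul, act_mul, act_one_inv, act_one_mul, act_mem]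
    have : h * (g * h)⁻¹ = g⁻¹ := by group
    rw [this, ← mul_assoc, act_mem]
  have h2 := α.map_map g h ⟨_, hm⟩ ⟨α.act h s * α.one g⁻¹, α.mul_one_mem _ _⟩
    ⟨s * α.one h⁻¹ * α.one (g * h)⁻¹, α.mul_one_mem _ _⟩ rfl
    (by rw [← act_coe]; exact h1.symm)
  rw [← act_coe, ← act_coe] at h2
  simp only at h2
  rw [act_mul, act_one_inv, act_mem, act_mul, act_mul, act_one_inv, act_one_mul] at h2
  have h3 : g * h * h⁻¹ = g := by group
  rw [h3] at h2
  have h4 := α.act_mem (g * h) s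
  have h5 := α.one_idem (g * h)
  rw [h2]
  linear_combination (α.one g + α.one g * α.one (g * h)) * h4

/-- A unital partial action from idempotents `1_g` and the maps `s ↦ α_g (s 1_{g⁻¹})`. -/
def ofAct (one : G → S) (act : G → S →ₗ[k] S)
    (act_mul : ∀ g s t, act g (s * t) = act g s * act g t)
    (act_one : ∀ g, act g 1 = one g) (act_one_apply : ∀ s, act 1 s = s)
    (act_act : ∀ g h s, act g (act h s) = act (g * h) s * one g) :
    UnitalPartialAction k G S :=
  have one_idem : ∀ g, one g * one g = one g := fun g => by
    rw [← act_one, ← act_mul, mul_one]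
  have mem : ∀ {g x}, x ∈ Ideal.span {one g} ↔ x * one g = x := fun {g x} => by
    rw [Ideal.mem_span_singleton']
    constructor
    · rintro ⟨a, rfl⟩
      rw [mul_assoc, one_idem]
    · intro h
      exact ⟨x, h⟩
  have act_mem : ∀ g s, act g s * one g = act g s := fun g s => by
    rw [← act_one, ← act_mul, mul_one]
  have inv1 : ∀ g s, act g (act g⁻¹ s) = s * one g := fun g s => by
    rw [act_act, mul_inv_cancel, act_one_apply]
  have inv2 : ∀ g s, act g⁻¹ (act g s) = s * one g⁻¹ := fun g s => by
    rw [act_act, inv_mul_cancel, act_one_apply]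
  have one_one : one 1 = 1 := by rw [← act_one, act_one_apply]
  have act_one' : ∀ g h, act g (one h) = one (g * h) * one g := fun g h => by
    rw [← act_one h, act_act, act_one]
  { ideal := fun g => Ideal.span {one g}
    map := fun g =>
      { toFun := fun x => ⟨act g x, mem.2 (act_mem g x)⟩
        map_add' := fun x y => Subtype.ext (map_add (act g) (x : S) y)
        map_smul' := fun c x => Subtype.ext (map_smul (act g) c (x : S))
        invFun := fun x => ⟨act g⁻¹ x, mem.2 (act_mem g⁻¹ x)⟩
        left_inv := fun x => Subtype.ext ((inv2 g x).trans (mem.1 x.2))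
        right_inv := fun x => Subtype.ext ((inv1 g x).trans (mem.1 x.2)) }
    map_mul := fun g x y => act_mul g x y
    ideal_one := by rw [one_one, Ideal.span_singleton_one]
    map_one := fun x => act_one_apply x
    map_inter := fun g h => by
      ext s
      constructor
      · rintro ⟨x, hx, rfl⟩
        refine ⟨mem.2 (act_mem g x), mem.2 ?_⟩
        change act g x * one (g * h) = act g x
        have h1 : act g ((x : S) * one h) = _ := act_mul g x (one h)
        rw [mem.1 hx, act_one', mul_comm (one (g * h)), ← mul_assoc, act_mem] at h1
        exact h1.symm
      · rintro ⟨hs, hs'⟩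
        have h1 := mem.1 hs
        have h2 := mem.1 hs'
        refine ⟨⟨act g⁻¹ s, mem.2 (act_mem _ s)⟩, mem.2 ?_, (inv1 g s).trans h1⟩
        change act g⁻¹ s * one h = act g⁻¹ s
        have h3 := act_mul g⁻¹ s (one (g * h))
        rw [h2, act_one', inv_mul_cancel_left, mul_comm (one h), ← mul_assoc, act_mem] at h3
        exact h3.symm
    map_map := fun g h x y z hz hy => by
      change act g (y : S) = act (g * h) (z : S)
      have hy' : (y : S) = act h (x : S) := hy
      have hz1 : act (g * h) ((z : S) * one h⁻¹) = _ := act_mul (g * h) z (one h⁻¹)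
      have hx : (z : S) * one h⁻¹ = z := by rw [hz]; exact mem.1 x.2
      rw [hx, act_one', mul_inv_cancel_right, mul_comm (one g), ← mul_assoc, act_mem] at hz1
      rw [hy', act_act, ← hz, ← hz1]
    one := one
    one_idem := one_idem
    ideal_eq := fun _ => rfl }

/-- The pullback `(S_{f h}, α_{f h})_{h}` of a partial action along a group homomorphism. -/
def comap {H : Type*} [Group H] (α : UnitalPartialAction k G S) (f : H →* G) :
    UnitalPartialAction k H S :=
  ofAct (fun h => α.one (f h)) (fun h => α.act (f h)) (fun h => α.act_mul (f h))
    (fun h => α.act_one (f h)) (fun s => by rw [map_one, act_one_apply])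
    (fun g h s => by rw [act_act, map_mul])

/-- The restriction `α_H = (S_h, α_h)_{h ∈ H}` to a subgroup. -/
def restrict (α : UnitalPartialAction k G S) (H : Subgroup G) : UnitalPartialAction k H S :=
  α.comap H.subtype

/-- The subalgebra of invariants `S^α = {s | α_g (s 1_{g⁻¹}) = s 1_g for all g}`. -/
def invariants (α : UnitalPartialAction k G S) : Subalgebra k S where
  carrier := {s | ∀ g, α.act g s = s * α.one g}
  mul_mem' {s t} hs ht g := by
    rw [act_mul, hs g, ht g]
    linear_combination (s * t) * α.one_idem g
  add_mem' {s t} hs ht g := by rw [map_add, hs g, ht g, add_mul]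
  algebraMap_mem' c g := by
    rw [Algebra.algebraMap_eq_smul_one, map_smul, act_one, smul_mul_assoc, one_mul]

/-- The partial action `α ⊗ α'` of `G × G'` on `S ⊗ S'`, with ideals `S_g ⊗ S'_h`, the ideal of
`S ⊗ S'` generated by `1_g ⊗ 1'_h`, and isomorphisms `α_g ⊗ α'_h`. -/
def tensor {G' S' : Type*} [Group G'] [CommRing S'] [Algebra k S']
    (α : UnitalPartialAction k G S) (α' : UnitalPartialAction k G' S') :
    UnitalPartialAction k (G × G') (S ⊗[k] S') :=
  ofAct (fun g => α.one g.1 ⊗ₜ α'.one g.2) (fun g => TensorProduct.map (α.act g.1) (α'.act g.2))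
    (fun g s t => by
      induction s using TensorProduct.induction_on with
      | zero => simp
      | add a b ha hb => rw [add_mul, map_add, ha, hb, map_add, add_mul]
      | tmul a b =>
        induction t using TensorProduct.induction_on with
        | zero => simp
        | add c d hc hd => rw [mul_add, map_add, hc, hd, map_add, mul_add]
        | tmul c d =>
          simp only [Algebra.TensorProduct.tmul_mul_tmul, TensorProduct.map_tmul, act_mul])
    (fun g => by
      rw [Algebra.TensorProduct.one_def, TensorProduct.map_tmul, act_one, act_one])
    (fun s => by
      induction s using TensorProduct.induction_on with
      | zero => simp
      | add a b ha hb => rw [map_add, ha, hb]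
      | tmul a b =>
        rw [TensorProduct.map_tmul, Prod.fst_one, Prod.snd_one, act_one_apply, act_one_apply])
    (fun g h s => by
      induction s using TensorProduct.induction_on with
      | zero => simp
      | add a b ha hb => rw [map_add, map_add, ha, hb, map_add, add_mul]
      | tmul a b =>
        simp only [Algebra.TensorProduct.tmul_mul_tmul, TensorProduct.map_tmul, act_act,
          Prod.fst_mul, Prod.snd_mul])

/-- `S` is a partial Galois extension of `k` with group `G` and partial action `α`:
`k ⊆ S`, `S^α = k`, and there are partial Galois coordinates. -/
structure IsPartialGalois (α : UnitalPartialAction k G S) : Prop where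
  injective : Function.Injective (algebraMap k S)
  invariants_eq : α.invariants = ⊥
  exists_coordinates : ∃ (m : ℕ) (x y : Fin m → S),
    ∑ i, x i * α.act 1 (y i) = 1 ∧ ∀ g : G, g ≠ 1 → ∑ i, x i * α.act g (y i) = 0

end

end UnitalPartialAction

/-- A globalization of a partial action: a global action `β` on a unital algebra `T` containing
(via the embedding `ι`) `S` as an ideal, such that `S_g = S ∩ β_g(S)`, `β_g` extends `α_g`, and
`T = ∑_g β_g(S)`. -/
structure PartialAction.Globalization {k G S : Type*} [CommRing k] [Group G] [CommRing S]
    [Algebra k S] (α : PartialAction k G S) where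
  /-- the algebra `T` -/
  T : Type w
  [commRing : CommRing T]
  [algebra : Algebra k T]
  /-- the global action -/
  β : G →* (T ≃ₐ[k] T)
  /-- the embedding of `S` in `T` -/
  ι : S →ₙₐ[k] T
  injective : Function.Injective ι
  isIdeal : ∀ (t : T) (s : S), t * ι s ∈ Set.range ι
  image_ideal : ∀ g : G, ι '' (α.ideal g) = Set.range ι ∩ β g '' Set.range ι
  extends_map : ∀ (g : G) (x : α.ideal g⁻¹), β g (ι x) = ι (α.map g x)
  span_eq_top : Submodule.span k (⋃ g : G, β g '' Set.range ι) = ⊤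

namespace PartialAction.Globalization

attribute [instance] commRing algebra

variable {k G S : Type*} [CommRing k] [Group G] [CommRing S] [Algebra k S]
  {α : PartialAction k G S} (Γ : α.Globalization) {H : Subgroup G}

/-- For `H = {h_0 = 1, h_1, …, h_m}`, the idempotent
`e_i = (1_T - β_{h_0}(1_S)) ⋯ (1_T - β_{h_{i-1}}(1_S)) β_{h_i}(1_S)` of `T`. -/
def e {m : ℕ} (h : Fin (m + 1) ≃ H) (i : Fin (m + 1)) : Γ.T :=
  (∏ j ∈ Finset.Iio i, (1 - Γ.β (h j) (Γ.ι 1))) * Γ.β (h i) (Γ.ι 1)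

/-- The map `ψ_H : T → T`, `ψ_H(t) = ∑_i β_{h_i}(t) e_i`. -/
def psi {m : ℕ} (h : Fin (m + 1) ≃ H) (t : Γ.T) : Γ.T :=
  ∑ i, Γ.β (h i) t * Γ.e h i

end PartialAction.Globalization

namespace UnitalPartialAction

/-- `γ` is the partial action `α_{G/H}` of `G/H` on `S^{α_H}` induced by `α`: for a globalization
`(T, β)` of `α`, and with `e_H = ψ_H(1_S)`, the idempotent generating its ideal at `gH` is
`e_H β_g(e_H) 1_S`, and its isomorphism at `gH` is `x ↦ β_g(ψ_H(x)) 1_S`. -/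
def IsQuotient {k : Type*} {G : Type v} {S : Type u} [CommRing k] [Group G] [CommRing S]
    [Algebra k S] (α : UnitalPartialAction k G S) (H : Subgroup G) [H.Normal]
    (γ : UnitalPartialAction k (G ⧸ H) (α.restrict H).invariants) : Prop :=
  ∃ (Γ : PartialAction.Globalization.{max u v} α.toPartialAction) (m : ℕ)
    (h : Fin (m + 1) ≃ H), h 0 = 1 ∧
    ∀ g : G,
      Γ.ι (γ.one (g : G ⧸ H)) =
        Γ.psi h (Γ.ι 1) * Γ.β g (Γ.psi h (Γ.ι 1)) * Γ.ι 1 ∧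
      ∀ x : γ.ideal (g : G ⧸ H)⁻¹,
        Γ.ι ((γ.map (g : G ⧸ H) x : (α.restrict H).invariants) : S) =
          Γ.β g (Γ.psi h (Γ.ι ((x : (α.restrict H).invariants) : S))) * Γ.ι 1

end UnitalPartialAction

/-- A partial Galois extension `(S, α)` of `R` with group `G`. (Such an `S` is a finitely generated
`R`-module, so that the universe of `R` contains all of them up to isomorphism.) -/
structure PartialGaloisExtension (R : Type u) (G : Type v) [CommRing R] [Group G] where
  /-- the ring `S` -/
  S : Type u
  [commRing : CommRing S]
  [algebra : Algebra R S]
  /-- the partial action -/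
  α : UnitalPartialAction R G S
  isPartialGalois : α.IsPartialGalois

namespace PartialGaloisExtension

attribute [instance] commRing algebra

section

variable {R : Type u} {G : Type v} [CommRing R] [Group G]

/-- Partial `G`-isomorphism: there is an `R`-algebra isomorphism `f : S → S'` such that
`f(S_g) ⊆ S'_g` and `f ∘ α_g = α'_g ∘ f` on `S_{g⁻¹}`. -/
def PartialIso (E E' : PartialGaloisExtension R G) : Prop :=
  ∃ (f : E.S ≃ₐ[R] E'.S) (hf : ∀ g, ∀ x ∈ E.α.ideal g, f x ∈ E'.α.ideal g),
    ∀ (g : G) (x : E.α.ideal g⁻¹), f (E.α.map g x) = E'.α.map g ⟨f x, hf g⁻¹ x x.2⟩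

end

end PartialGaloisExtension

namespace UnitalPartialAction

/-- Traces lie in the base ring. -/
theorem IsPartialGalois.trace_mem {R G S : Type*} [CommRing R] [Group G] [Fintype G]
    [CommRing S] [Algebra R S] {α : UnitalPartialAction R G S} (hα : α.IsPartialGalois) (s : S) :
    ∃ r : R, algebraMap R S r = ∑ g, α.act g s := by
  have : (∑ g, α.act g s) ∈ α.invariants := by
    intro h
    rw [map_sum, Finset.sum_mul]
    simp only [act_act]
    exact Fintype.sum_bijective (fun g => h * g) (Group.mulLeft_bijective h) _ _ (fun _ => rfl)
  rw [hα.invariants_eq, Algebra.mem_bot] at this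
  exact this

/-- A bijective homomorphism of partial Galois extensions that maps `S_g` into `S'_g` maps the
generator `1_g` of `S_g` to the generator of `S'_g`. -/
theorem IsPartialGalois.map_one_eq {R G S S' : Type*} [CommRing R] [Group G] [Finite G]
    [CommRing S] [CommRing S'] [Algebra R S] [Algebra R S'] {α : UnitalPartialAction R G S}
    {α' : UnitalPartialAction R G S'} (hα : α.IsPartialGalois) (hα' : α'.IsPartialGalois)
    (f : S ≃ₐ[R] S') (h1 : ∀ g, f (α.one g) * α'.one g = f (α.one g))
    (h2 : ∀ g s, f (α.act g s) = α'.act g (f s) * f (α.one g)) (g : G) :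
    f (α.one g) = α'.one g := by
  classical
  cases nonempty_fintype G
  obtain ⟨m, x, y, hxy1, hxy⟩ := hα'.exists_coordinates
  have hxyd : ∀ g, ∑ i, x i * α'.act g (y i) = if g = 1 then 1 else 0 := by
    intro g
    split_ifs with hg
    · rw [hg, hxy1]
    · exact hxy g hg
  have hyxd : ∀ g, ∑ i, y i * α'.act g (x i) = if g = 1 then 1 else 0 := by
    intro g
    have h3 : α'.act g (∑ i, x i * α'.act g⁻¹ (y i)) = ∑ i, y i * α'.act g (x i) := by
      rw [map_sum]
      refine Finset.sum_congr rfl fun i _ => ?_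
      rw [act_mul, act_act, mul_inv_cancel, act_one_apply]
      linear_combination y i * α'.act_mem g (x i)
    rw [← h3, hxyd]
    by_cases hg : g = 1
    · simp [hg, act_one_apply]
    · simp [hg]
  set u' : G → S' := fun g => α'.one g - f (α.one g) with hu'
  have d_mem : ∀ s, ∃ r : R, algebraMap R S' r = ∑ g, α'.act g s * u' g := by
    intro s
    obtain ⟨r, hr⟩ := hα'.trace_mem s
    obtain ⟨q, hq⟩ := hα.trace_mem (f.symm s)
    refine ⟨r - q, ?_⟩
    have hq' := congrArg f hq
    rw [f.commutes, map_sum] at hq'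
    simp only [h2, f.apply_symm_apply] at hq'
    rw [map_sub, hr, hq', ← Finset.sum_sub_distrib]
    refine Finset.sum_congr rfl fun g _ => ?_
    rw [hu']
    linear_combination -α'.act_mem g s
  choose d hd using d_mem
  have act_smul : ∀ g (r : R) s, α'.act g (algebraMap R S' r * s) =
      algebraMap R S' r * α'.act g s := by
    intro g r s
    rw [← Algebra.smul_def, map_smul, Algebra.smul_def]
  have u_one : u' 1 = 0 := by simp [hu', one_one]
  -- the functional `s ↦ ∑ α'_g(s) u_g` is `s ↦ tr (c s)` with `c = u_1 = 0`
  have c_eq : ∑ i, y i * algebraMap R S' (d (x i)) = 0 := by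
    simp only [hd, Finset.mul_sum]
    rw [Finset.sum_comm]
    have : ∀ g, ∑ i, y i * (α'.act g (x i) * u' g) = 0 := by
      intro g
      have h4 : ∑ i, y i * (α'.act g (x i) * u' g) = (∑ i, y i * α'.act g (x i)) * u' g := by
        rw [Finset.sum_mul]
        exact Finset.sum_congr rfl fun i _ => by ring
      rw [h4, hyxd]
      by_cases hg : g = 1
      · simp [hg, u_one]
      · simp [hg]
    exact Finset.sum_eq_zero fun g _ => this g
  have expand : ∀ s, ∑ i, x i * ∑ g, α'.act g (y i * s) = s := by
    intro s
    simp only [Finset.mul_sum]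
    rw [Finset.sum_comm]
    have : ∀ g, ∑ i, x i * α'.act g (y i * s) = if g = 1 then s else 0 := by
      intro g
      have h4 : ∑ i, x i * α'.act g (y i * s) =
          (∑ i, x i * α'.act g (y i)) * α'.act g s := by
        rw [Finset.sum_mul]
        exact Finset.sum_congr rfl fun i _ => by rw [act_mul]; ring
      rw [h4, hxyd]
      by_cases hg : g = 1
      · simp [hg, act_one_apply]
      · simp [hg]
    simp [this]
  have d_zero : ∀ s, ∑ g, α'.act g s * u' g = 0 := by
    intro s
    choose t ht using fun i => hα'.trace_mem (y i * s)
    have h5 : ∑ g, α'.act g s * u' g = ∑ i, algebraMap R S' (t i) * algebraMap R S' (d (x i)) := by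
      conv_lhs => rw [← expand s]
      simp only [← ht, hd, map_sum, Finset.sum_mul, Finset.mul_sum]
      rw [Finset.sum_comm]
      refine Finset.sum_congr rfl fun i _ => Finset.sum_congr rfl fun g _ => ?_
      rw [mul_comm (x i), act_smul, mul_assoc]
    have h6 : ∑ i, algebraMap R S' (t i) * algebraMap R S' (d (x i)) =
        ∑ g, α'.act g ((∑ i, y i * algebraMap R S' (d (x i))) * s) := by
      simp only [ht, Finset.sum_mul, map_sum]
      rw [Finset.sum_comm]
      refine Finset.sum_congr rfl fun g _ => Finset.sum_congr rfl fun i _ => ?_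
      rw [mul_comm (y i) (algebraMap R S' (d (x i))), mul_assoc, act_smul, mul_comm]
    rw [h5, h6, c_eq]
    simp
  have hu : u' g = 0 := by
    have key : ∀ h, ∑ i, α'.act g (x i) * α'.act h (y i) = if h = g then α'.one g else 0 := by
      intro h
      have h7 : ∑ i, α'.act g (x i) * α'.act h (y i) =
          α'.act g (∑ i, x i * α'.act (g⁻¹ * h) (y i)) := by
        rw [map_sum]
        refine Finset.sum_congr rfl fun i _ => ?_
        rw [act_mul, act_act, mul_inv_cancel_left]
        linear_combination -α'.act h (y i) * α'.act_mem g (x i)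
      rw [h7, hxyd]
      by_cases hg : h = g
      · simp [hg, act_one]
      · have : ¬ g⁻¹ * h = 1 := fun hh => hg (inv_mul_eq_one.1 hh).symm
        simp [hg, this]
    have h8 : ∑ i, α'.act g (x i) * ∑ h, α'.act h (y i) * u' h = α'.one g * u' g := by
      simp only [Finset.mul_sum]
      rw [Finset.sum_comm]
      have : ∀ h, ∑ i, α'.act g (x i) * (α'.act h (y i) * u' h) =
          if h = g then α'.one g * u' g else 0 := by
        intro h
        have h9 : ∑ i, α'.act g (x i) * (α'.act h (y i) * u' h) =
            (∑ i, α'.act g (x i) * α'.act h (y i)) * u' h := by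
          rw [Finset.sum_mul]
          exact Finset.sum_congr rfl fun i _ => by ring
        rw [h9, key]
        by_cases hg : h = g
        · simp [hg]
        · simp [hg]
      simp [this]
    simp only [d_zero, mul_zero, Finset.sum_const_zero] at h8
    have h10 : α'.one g * u' g = u' g := by
      simp only [hu']
      linear_combination α'.one_idem g - h1 g
    rw [← h10, ← h8]
  exact (sub_eq_zero.1 hu).symm

end UnitalPartialAction

namespace PartialGaloisExtension

variable {R : Type u} {G : Type v} [CommRing R] [Group G]

theorem PartialIso.refl (E : PartialGaloisExtension R G) : PartialIso E E :=
  ⟨AlgEquiv.refl, fun _ _ hx => hx, fun _ _ => rfl⟩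

theorem PartialIso.trans {E E' E'' : PartialGaloisExtension R G} (h : PartialIso E E')
    (h' : PartialIso E' E'') : PartialIso E E'' := by
  obtain ⟨f, hf, hf'⟩ := h
  obtain ⟨f₁, hf₁, hf₁'⟩ := h'
  refine ⟨f.trans f₁, fun g x hx => hf₁ g _ (hf g x hx), fun g x => ?_⟩
  change f₁ (f _) = _
  rw [hf', hf₁']
  rfl

theorem PartialIso.symm [Finite G] {E E' : PartialGaloisExtension R G} (h : PartialIso E E') :
    PartialIso E' E := by
  obtain ⟨f, hf, hf'⟩ := h
  have h1 : ∀ g, f (E.α.one g) * E'.α.one g = f (E.α.one g) := fun g =>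
    E'.α.mem_ideal.1 (hf g _ (E.α.mem_ideal.2 (E.α.one_idem g)))
  have h0 : ∀ g s, f (E.α.act g s) = E'.α.act g (f (s * E.α.one g⁻¹)) := fun g s => by
    rw [E.α.act_def, hf', ← E'.α.act_coe]
  have h2 : ∀ g s, f (E.α.act g s) = E'.α.act g (f s) * f (E.α.one g) := fun g s => by
    rw [h0, map_mul, E'.α.act_mul]
    congr 1
    rw [← E.α.act_one g, h0, one_mul]
  have h3 := fun g => E.isPartialGalois.map_one_eq E'.isPartialGalois f h1 h2 g
  have h4 : ∀ g, ∀ x ∈ E'.α.ideal g, f.symm x ∈ E.α.ideal g := by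
    intro g x hx
    rw [E.α.mem_ideal]
    apply f.injective
    rw [map_mul, f.apply_symm_apply, h3]
    exact E'.α.mem_ideal.1 hx
  refine ⟨f.symm, h4, fun g x => ?_⟩
  apply f.injective
  rw [f.apply_symm_apply, hf']
  congr 2
  exact Subtype.ext (f.apply_symm_apply _).symm

instance setoid (R : Type u) (G : Type v) [CommRing R] [Group G] [Finite G] :
    Setoid (PartialGaloisExtension R G) where
  r := PartialIso
  iseqv := ⟨PartialIso.refl, PartialIso.symm, PartialIso.trans⟩

end PartialGaloisExtension

/-- The set `H_par(G, R)` of partial isomorphism classes of partial Galois extensions of `R` with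
group `G`. -/
def HPar (R : Type u) (G : Type v) [CommRing R] [Group G] [Finite G] : Type (max (u + 1) v) :=
  Quotient (PartialGaloisExtension.setoid R G)

/-- The class `[S, α]`. -/
def HPar.mk {R : Type u} {G : Type v} [CommRing R] [Group G] [Finite G]
    (E : PartialGaloisExtension R G) : HPar R G :=
  Quotient.mk _ E

/-- The subgroup `δG = {(g, g⁻¹) | g ∈ G}` of `G × G`. -/
def antidiagonal (G : Type v) [CommGroup G] : Subgroup (G × G) where
  carrier := {p | p.2 = p.1⁻¹}
  one_mem' := by simp
  mul_mem' {p q} hp hq := by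
    simp only [Set.mem_ofPred_eq, Prod.fst_mul, Prod.snd_mul] at *
    rw [hp, hq, mul_inv]
  inv_mem' {p} hp := by
    simp only [Set.mem_ofPred_eq, Prod.fst_inv, Prod.snd_inv] at *
    rw [hp]

/-- The isomorphism `G → (G × G)/δG`, `g ↦ (g, 1) δG`, by which the two groups are identified. -/
noncomputable def toQuotientAntidiagonal (G : Type v) [CommGroup G] :
    G ≃* (G × G) ⧸ antidiagonal G :=
  MulEquiv.ofBijective ((QuotientGroup.mk' (antidiagonal G)).comp (MonoidHom.inl G G)) <| by
    constructor
    · rw [injective_iff_map_eq_one]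
      intro g hg
      have h : (g, (1 : G)) ∈ antidiagonal G := (QuotientGroup.eq_one_iff _).1 hg
      have h' : (1 : G) = g⁻¹ := h
      exact inv_eq_one.1 h'.symm
    · intro q
      obtain ⟨⟨a, b⟩, rfl⟩ := QuotientGroup.mk_surjective q
      refine ⟨a * b, ?_⟩
      change ((a * b, (1 : G)) : (G × G) ⧸ antidiagonal G) = ((a, b) : G × G)
      rw [QuotientGroup.eq]
      change (1 : G)⁻¹ * b = ((a * b)⁻¹ * a)⁻¹
      simp [mul_comm]

/-- The partial Galois extension `P` is `(S ⊗ S')^{δG}` with the partial action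
`(α ⊗ α')_{(G × G)/δG}` of `(G × G)/δG = G`. -/
def IsHarrisonProduct {R : Type u} {G : Type v} [CommRing R] [CommGroup G]
    (E E' P : PartialGaloisExtension R G) : Prop :=
  ∃ γ : UnitalPartialAction R ((G × G) ⧸ antidiagonal G)
      ((E.α.tensor E'.α).restrict (antidiagonal G)).invariants,
    (E.α.tensor E'.α).IsQuotient (antidiagonal G) γ ∧
    ∃ hγ : (γ.comap (toQuotientAntidiagonal G).toMonoidHom).IsPartialGalois,
      P = ⟨((E.α.tensor E'.α).restrict (antidiagonal G)).invariants,
        γ.comap (toQuotientAntidiagonal G).toMonoidHom, hγ⟩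

/-! The quotient action is defined through a globalization and an enumeration of H, and both
disappear once it is read inside S. Multiplied by 1_S, the element β_g(ψ_H(s)) becomes ∑_i
α_{gh_i}(s) ∏_{j<i} (1 - 1_{gh_j}). For an H-invariant s this element lies in the ideal generated by
the idempotents 1_x with x ∈ gH, and its product with each such 1_x is α_x(s). An element of that
ideal is determined by these products, so the two properties characterise the quotient action.
`IsQuotientAlong` records them for an arbitrary homomorphism φ in place of G → G/H, and
`isQuotient_iff` is the equivalence with the definition.

The semigroup laws are then formal. Under the identification of (G × G)/δG with G the quotient map
is multiplication, so the product of two classes is the quotient of α ⊗ α' along G × G → G.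
Quotients along a given map are unique (`exists_algEquiv`), follow isomorphisms (`transport`) and
compose (`comp`). Uniqueness and transport give commutativity and independence of representatives.
Both bracketings of a triple product are quotients of the triple tensor product along (a, b, c) ↦
abc, which gives associativity as soon as a quotient tensored with a further factor is again a
quotient (`tensor_right`).

The Galois hypothesis enters through an element c of trace one, obtained from the coordinates by
Nakayama's lemma. The map w ↦ tr(cw) is a retraction onto the invariants. Hence taking invariants
commutes with tensor products although nothing is assumed about R, and traces of coordinates give
coordinates of the quotient (`IsQuotientAlong.isPartialGalois`). -/

namespace UnitalPartialAction

/-! ### Partial actions through their total maps `act`; traces -/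

section Basic

variable {k G S : Type*} [CommRing k] [Group G] [CommRing S] [Algebra k S]

theorem ofAct_act (one : G → S) (act : G → S →ₗ[k] S)
    (act_mul : ∀ g s t, act g (s * t) = act g s * act g t)
    (act_one : ∀ g, act g 1 = one g) (act_one_apply : ∀ s, act 1 s = s)
    (act_act : ∀ g h s, act g (act h s) = act (g * h) s * one g) (g : G) (s : S) :
    (ofAct one act act_mul act_one act_one_apply act_act).act g s = act g s := by
  rw [act_def]
  change act g (s * one g⁻¹) = act g s
  rw [act_mul, ← act_one g⁻¹, act_act, mul_inv_cancel, act_one_apply, one_mul, ← act_one,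
    ← act_mul, mul_one]

theorem comap_act {H : Type*} [Group H] (α : UnitalPartialAction k G S) (f : H →* G) (h : H)
    (s : S) : (α.comap f).act h s = α.act (f h) s :=
  ofAct_act ..

theorem restrict_act (α : UnitalPartialAction k G S) (H : Subgroup G) (h : H) (s : S) :
    (α.restrict H).act h s = α.act h s :=
  comap_act ..

theorem mem_restrict_invariants (α : UnitalPartialAction k G S) (H : Subgroup G) {s : S} :
    s ∈ (α.restrict H).invariants ↔ ∀ h ∈ H, α.act h s = s * α.one h := by
  change (∀ h : H, (α.restrict H).act h s = s * α.one h) ↔ _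
  simp only [restrict_act, Subtype.forall]

theorem tensor_act {G' S' : Type*} [Group G'] [CommRing S'] [Algebra k S']
    (α : UnitalPartialAction k G S) (α' : UnitalPartialAction k G' S') (g : G × G')
    (s : S ⊗[k] S') :
    (α.tensor α').act g s = TensorProduct.map (α.act g.1) (α'.act g.2) s :=
  ofAct_act ..

theorem tensor_act_tmul {G' S' : Type*} [Group G'] [CommRing S'] [Algebra k S']
    (α : UnitalPartialAction k G S) (α' : UnitalPartialAction k G' S') (g : G × G')
    (s : S) (s' : S') :
    (α.tensor α').act g (s ⊗ₜ s') = α.act g.1 s ⊗ₜ α'.act g.2 s' := by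
  rw [tensor_act, TensorProduct.map_tmul]

theorem tensor_one {G' S' : Type*} [Group G'] [CommRing S'] [Algebra k S']
    (α : UnitalPartialAction k G S) (α' : UnitalPartialAction k G' S') (g : G × G') :
    (α.tensor α').one g = α.one g.1 ⊗ₜ α'.one g.2 := rfl

theorem ext_act {α α' : UnitalPartialAction k G S} (h : ∀ g s, α.act g s = α'.act g s) :
    α = α' := by
  have h1 : α.one = α'.one := funext fun g => by rw [← act_one, ← act_one, h]
  have h2 : α.ideal = α'.ideal := funext fun g => by rw [ideal_eq, ideal_eq, h1]
  have h3 : ∀ g (x : S) (hx : x ∈ α.ideal g⁻¹) (hx' : x ∈ α'.ideal g⁻¹),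
      (α.map g ⟨x, hx⟩ : S) = α'.map g ⟨x, hx'⟩ := fun g x hx hx' => by
    rw [← act_coe, ← act_coe, h]
  obtain ⟨⟨I, m, _, _, _, _, _⟩, one, _, _⟩ := α
  obtain ⟨⟨I', m', _, _, _, _, _⟩, one', _, _⟩ := α'
  simp only at h1 h2
  subst h1 h2
  have h4 : m = m' := funext fun g => LinearEquiv.ext fun x =>
    Subtype.ext (h3 g x x.2 x.2)
  subst h4
  rfl

/-- Apply α_g to the coordinate relation for g⁻¹h. -/
theorem sum_act_mul_act {m : ℕ} {α : UnitalPartialAction k G S} {x y : Fin m → S}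
    (h1 : ∑ i, x i * α.act 1 (y i) = 1) (h2 : ∀ g : G, g ≠ 1 → ∑ i, x i * α.act g (y i) = 0)
    [DecidableEq G] (g h : G) :
    ∑ i, α.act g (x i) * α.act h (y i) = if g = h then α.one g else 0 := by
  have h3 : ∑ i, α.act g (x i) * α.act h (y i) =
      α.act g (∑ i, x i * α.act (g⁻¹ * h) (y i)) := by
    rw [map_sum]
    refine Finset.sum_congr rfl fun i _ => ?_
    rw [act_mul, act_act, mul_inv_cancel_left]
    linear_combination -α.act h (y i) * α.act_mem g (x i)
  rw [h3]
  split_ifs with hg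
  · rw [hg, inv_mul_cancel, h1, act_one]
  · rw [h2 _ fun h => hg (inv_mul_eq_one.1 h), map_zero]

/-- Some element has trace one, if there are partial Galois coordinates. -/
theorem exists_sum_act_eq_one [Fintype G] (α : UnitalPartialAction k G S)
    (h : ∃ (m : ℕ) (x y : Fin m → S),
      ∑ i, x i * α.act 1 (y i) = 1 ∧ ∀ g : G, g ≠ 1 → ∑ i, x i * α.act g (y i) = 0) :
    ∃ c, ∑ g, α.act g c = 1 := by
  classical
  obtain ⟨m, x, y, h1, h2⟩ := h
  have tr_mem : ∀ s, ∑ g, α.act g s ∈ α.invariants := fun s h => by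
    rw [map_sum, Finset.sum_mul]
    simp only [act_act]
    exact Fintype.sum_bijective (fun g => h * g) (Group.mulLeft_bijective h) _ _ (fun _ => rfl)
  have act_smul : ∀ (a : α.invariants) g s, α.act g (a * s) = a * α.act g s := fun a g s => by
    rw [act_mul, a.2 g]
    linear_combination (a : S) * α.act_mem g s
  have expand : ∀ s, ∑ i, x i * ∑ g, α.act g (y i * s) = s := by
    intro s
    simp only [Finset.mul_sum]
    rw [Finset.sum_comm]
    have : ∀ g, ∑ i, x i * α.act g (y i * s) = if (1 : G) = g then s else 0 := by
      intro g
      have h4 : ∑ i, x i * α.act g (y i * s) =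
          (∑ i, α.act 1 (x i) * α.act g (y i)) * α.act g s := by
        rw [Finset.sum_mul]
        exact Finset.sum_congr rfl fun i _ => by rw [act_mul, act_one_apply]; ring
      rw [h4, sum_act_mul_act h1 h2]
      split_ifs with hg
      · rw [← hg, one_one, act_one_apply, one_mul]
      · rw [zero_mul]
    simp [this]
  let tr : S →ₗ[α.invariants] α.invariants :=
    { toFun := fun s => ⟨∑ g, α.act g s, tr_mem s⟩
      map_add' := fun s t => Subtype.ext <| by
        simp only [map_add, Finset.sum_add_distrib]; rfl
      map_smul' := fun a s => Subtype.ext <| by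
        change ∑ g, α.act g (a * s) = a * ∑ g, α.act g s
        rw [Finset.mul_sum]
        exact Finset.sum_congr rfl fun g _ => act_smul a g s }
  -- The coordinates give a dual basis: the x_i span S over the invariants with coefficients in the
  -- image I of the trace. So S is finitely generated and I S = S.
  have expand' : ∀ s, s = ∑ i, tr (y i * s) • x i := fun s => by
    conv_lhs => rw [← expand s]
    exact Finset.sum_congr rfl fun i _ => mul_comm _ _
  have hfg : (⊤ : Submodule α.invariants S).FG := by
    refine ⟨Finset.univ.image x, top_le_iff.1 fun s _ => ?_⟩
    rw [expand' s]
    exact Submodule.sum_mem _ fun i _ => Submodule.smul_mem _ _ (Submodule.subset_span (by simp))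
  -- Nakayama's lemma: some r with r - 1 ∈ I kills S. Since 1 ∈ S, r = 0, so -1 is a trace.
  obtain ⟨r, hr, hr'⟩ := Submodule.exists_sub_one_mem_and_smul_eq_zero_of_fg_of_le_smul
    (LinearMap.range tr : Ideal α.invariants) ⊤ hfg (fun s _ => by
      rw [expand' s]
      exact Submodule.sum_mem _ fun i _ => Submodule.smul_mem_smul ⟨_, rfl⟩ trivial)
  have hr0 : r = 0 := Subtype.ext (by simpa [Subalgebra.smul_def] using hr' 1 trivial)
  obtain ⟨c, hc⟩ := hr
  refine ⟨-c, ?_⟩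
  have hc' := congrArg Subtype.val hc
  change ∑ g, α.act g c = ((r - 1 : α.invariants) : S) at hc'
  simp only [map_neg, Finset.sum_neg_distrib, hc', hr0]
  simp

end Basic

/-- `γ` is a quotient of the partial action `ω` of `Γ` on `W` along `φ : Γ → G`: `j` identifies `P`
with the invariants of `ker φ`, and `γ_g` is glued from the maps `ω_x` with `φ x = g`. -/
structure IsQuotientAlong {k Γ G W P : Type*} [CommRing k] [Group Γ] [Group G] [CommRing W]
    [CommRing P] [Algebra k W] [Algebra k P] (φ : Γ →* G) (j : P →ₐ[k] W)
    (ω : UnitalPartialAction k Γ W) (γ : UnitalPartialAction k G P) : Prop where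
  injective : Function.Injective j
  mem_range : ∀ w, w ∈ Set.range j ↔ ∀ x, φ x = 1 → ω.act x w = w * ω.one x
  act_mul_one : ∀ x p, j (γ.act (φ x) p) * ω.one x = ω.act x (j p)
  one_mem : ∀ g, j (γ.one g) ∈ Ideal.span (ω.one '' (φ ⁻¹' {g}))

/-! ### Quotients along a homomorphism: uniqueness, composition, transport -/

namespace IsQuotientAlong

variable {k Γ G W P : Type*} [CommRing k] [Group Γ] [Group G] [CommRing W]
    [CommRing P] [Algebra k W] [Algebra k P] {φ : Γ →* G} {j : P →ₐ[k] W}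
    {ω : UnitalPartialAction k Γ W} {γ : UnitalPartialAction k G P}

theorem one_mul_one (h : IsQuotientAlong φ j ω γ) (x : Γ) :
    j (γ.one (φ x)) * ω.one x = ω.one x := by
  rw [← act_one, h.act_mul_one, _root_.map_one, act_one]

theorem one_mul_of_mem (h : IsQuotientAlong φ j ω γ) {g : G} {a : W}
    (ha : a ∈ Ideal.span (ω.one '' (φ ⁻¹' {g}))) : j (γ.one g) * a = a := by
  induction ha using Submodule.span_induction with
  | mem a ha =>
    obtain ⟨x, rfl, rfl⟩ := ha
    exact h.one_mul_one x
  | zero => rw [mul_zero]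
  | add a b _ _ ha hb => rw [mul_add, ha, hb]
  | smul a b _ hb => rw [smul_eq_mul, mul_left_comm, hb]

theorem mul_one_eq_zero (h : IsQuotientAlong φ j ω γ) {g : G} {a : W}
    (ha : ∀ x, φ x = g → a * ω.one x = 0) : a * j (γ.one g) = 0 := by
  have key : ∀ b ∈ Ideal.span (ω.one '' (φ ⁻¹' {g})), a * b = 0 := by
    intro b hb
    induction hb using Submodule.span_induction with
    | mem b hb =>
      obtain ⟨x, hx, rfl⟩ := hb
      exact ha x hx
    | zero => rw [mul_zero]
    | add b c _ _ hb hc => rw [mul_add, hb, hc, add_zero]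
    | smul c b _ hb => rw [smul_eq_mul, mul_left_comm, hb, mul_zero]
  exact key _ (h.one_mem g)

/-- Elements of the ideal of `g` are determined by their products with the `1_x`. -/
theorem eq_of_mul_one (h : IsQuotientAlong φ j ω γ) {g : G} {a b : W}
    (ha : a * j (γ.one g) = a) (hb : b * j (γ.one g) = b)
    (hab : ∀ x, φ x = g → a * ω.one x = b * ω.one x) : a = b := by
  rw [← sub_eq_zero, ← ha, ← hb, ← sub_mul]
  exact h.mul_one_eq_zero fun x hx => by rw [sub_mul, hab x hx, sub_self]

theorem act_mul_one_self (_ : IsQuotientAlong φ j ω γ) (g : G) (p : P) :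
    j (γ.act g p) * j (γ.one g) = j (γ.act g p) := by
  rw [← map_mul, act_mem]

theorem map_one_eq {P' : Type*} [CommRing P'] [Algebra k P'] {j' : P' →ₐ[k] W}
    {γ' : UnitalPartialAction k G P'} (h : IsQuotientAlong φ j ω γ)
    (h' : IsQuotientAlong φ j' ω γ') (g : G) : j (γ.one g) = j' (γ'.one g) := by
  rw [← h.one_mul_of_mem (h'.one_mem g), mul_comm, h'.one_mul_of_mem (h.one_mem g)]

/-- Both embeddings have the same image in W, namely the invariants of ker φ. The resulting
isomorphism respects the actions because on each 1_x both sides equal ω_x(j p). -/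
theorem exists_algEquiv {P' : Type*} [CommRing P'] [Algebra k P'] {j' : P' →ₐ[k] W}
    {γ' : UnitalPartialAction k G P'} (h : IsQuotientAlong φ j ω γ)
    (h' : IsQuotientAlong φ j' ω γ') :
    ∃ f : P ≃ₐ[k] P', (∀ p, j' (f p) = j p) ∧ ∀ g p, f (γ.act g p) = γ'.act g (f p) := by
  have hr : j.range = j'.range := by
    ext w
    exact (h.mem_range w).trans (h'.mem_range w).symm
  let f : P ≃ₐ[k] P' := ((AlgEquiv.ofInjective j h.injective).trans
    (Subalgebra.equivOfEq _ _ hr)).trans (AlgEquiv.ofInjective j' h'.injective).symm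
  have hf : ∀ p, j' (f p) = j p := fun p => by
    have := AlgEquiv.apply_symm_apply (AlgEquiv.ofInjective j' h'.injective)
      (Subalgebra.equivOfEq _ _ hr (AlgEquiv.ofInjective j h.injective p))
    exact congrArg Subtype.val this
  refine ⟨f, hf, fun g p => h'.injective ?_⟩
  rw [hf]
  refine h.eq_of_mul_one (h.act_mul_one_self g p) ?_ ?_
  · rw [h.map_one_eq h', h'.act_mul_one_self]
  · rintro x rfl
    rw [h.act_mul_one, h'.act_mul_one, hf]

theorem eq_of_subalgebra {A : Subalgebra k W} {γ γ' : UnitalPartialAction k G A}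
    (h : IsQuotientAlong φ A.val ω γ) (h' : IsQuotientAlong φ A.val ω γ') : γ = γ' := by
  obtain ⟨f, hf, hf'⟩ := h.exists_algEquiv h'
  have : ∀ p, f p = p := fun p => Subtype.ext (hf p)
  exact ext_act fun g s => by simpa only [this] using hf' g s

/-- The gluing relations chain together because j(1_{φ x}) is an identity for 1_x. An element of W
invariant under the kernel of the composite first descends to P; its invariance there is tested on
the idempotents 1_x. -/
theorem comp {G' P' : Type*} [Group G'] [CommRing P'] [Algebra k P'] {ψ : G →* G'}
    {i : P' →ₐ[k] P} {γ' : UnitalPartialAction k G' P'} (h : IsQuotientAlong φ j ω γ)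
    (h' : IsQuotientAlong ψ i γ γ') : IsQuotientAlong (ψ.comp φ) (j.comp i) ω γ' where
  injective := h.injective.comp h'.injective
  mem_range w := by
    constructor
    · rintro ⟨p, rfl⟩ x hx
      have h1 := (h'.mem_range (i p)).1 ⟨p, rfl⟩ (φ x) hx
      rw [AlgHom.comp_apply, ← h.act_mul_one, h1, map_mul, mul_assoc, h.one_mul_one]
    · intro hw
      obtain ⟨p, rfl⟩ := (h.mem_range w).2 fun x hx => hw x (by
        rw [MonoidHom.comp_apply, hx, _root_.map_one])
      obtain ⟨q, rfl⟩ := (h'.mem_range p).2 fun g hg => h.injective <| by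
        refine h.eq_of_mul_one (h.act_mul_one_self g p) ?_ ?_
        · rw [← map_mul, mul_assoc, one_idem]
        · rintro x rfl
          rw [h.act_mul_one, hw x hg, map_mul, mul_assoc, h.one_mul_one]
      exact ⟨q, rfl⟩
  act_mul_one x p := by
    rw [AlgHom.comp_apply, AlgHom.comp_apply, ← h.act_mul_one, ← h'.act_mul_one, map_mul, mul_assoc,
      h.one_mul_one]
    rfl
  one_mem g := by
    have h1 := Ideal.mem_map_of_mem j (h'.one_mem g)
    rw [Ideal.map_span] at h1
    refine (Ideal.span_le.2 ?_ : _ ≤ Ideal.span _) h1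
    rintro _ ⟨_, ⟨a, rfl, rfl⟩, rfl⟩
    refine Ideal.span_mono ?_ (h.one_mem a)
    rintro _ ⟨x, rfl, rfl⟩
    exact ⟨x, rfl, rfl⟩

theorem transport {Γ' W' : Type*} [Group Γ'] [CommRing W'] [Algebra k W']
    {ω' : UnitalPartialAction k Γ' W'} {φ' : Γ' →* G} (h : IsQuotientAlong φ j ω γ)
    (σ : Γ ≃* Γ') (F : W ≃ₐ[k] W') (hσ : ∀ x, φ' (σ x) = φ x)
    (hF : ∀ x w, F (ω.act x w) = ω'.act (σ x) (F w)) :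
    IsQuotientAlong φ' ((F : W →ₐ[k] W').comp j) ω' γ := by
  have hF1 : ∀ x, F (ω.one x) = ω'.one (σ x) := fun x => by
    rw [← act_one, hF, _root_.map_one, act_one]
  refine ⟨F.injective.comp h.injective, fun w => ?_, fun x p => ?_, fun g => ?_⟩
  · obtain ⟨w, rfl⟩ := F.surjective w
    have h1 : F w ∈ Set.range ((F : W →ₐ[k] W').comp j) ↔ w ∈ Set.range j :=
      exists_congr fun p => F.injective.eq_iff
    rw [h1, h.mem_range, σ.surjective.forall]
    refine forall_congr' fun x => ?_
    rw [hσ, ← hF, ← hF1, ← map_mul, F.injective.eq_iff]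
  · obtain ⟨x, rfl⟩ := σ.surjective x
    rw [hσ, ← hF1]
    exact (map_mul F _ _).symm.trans ((congrArg F (h.act_mul_one x p)).trans (hF _ _))
  · have h1 := Ideal.mem_map_of_mem F (h.one_mem g)
    rw [Ideal.map_span] at h1
    refine Ideal.span_mono ?_ h1
    rintro _ ⟨_, ⟨x, rfl, rfl⟩, rfl⟩
    exact ⟨σ x, hσ x, (hF1 x).symm⟩

theorem comap {G' : Type*} [Group G'] {φ' : Γ →* G'} (h : IsQuotientAlong φ j ω γ) (e : G' ≃* G)
    (he : ∀ x, e (φ' x) = φ x) : IsQuotientAlong φ' j ω (γ.comap e.toMonoidHom) where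
  injective := h.injective
  mem_range w := by
    rw [h.mem_range]
    refine forall_congr' fun x => ?_
    rw [← he, map_eq_one_iff e e.injective]
  act_mul_one x p := by
    rw [comap_act, ← h.act_mul_one, ← he]
    rfl
  one_mem g := by
    refine Ideal.span_mono ?_ (h.one_mem (e g))
    rintro _ ⟨x, hx, rfl⟩
    exact ⟨x, e.injective ((he x).trans hx), rfl⟩

end IsQuotientAlong

end UnitalPartialAction

namespace UnitalPartialAction

/-! ### Galois property and tensor products of quotients -/

namespace IsQuotientAlong

variable {k Γ G W P : Type*} [CommRing k] [Group Γ] [Group G] [CommRing W]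
    [CommRing P] [Algebra k W] [Algebra k P] {φ : Γ →* G} {j : P →ₐ[k] W}
    {ω : UnitalPartialAction k Γ W} {γ : UnitalPartialAction k G P}

theorem exists_eq_sum_ker [Fintype φ.ker] (h : IsQuotientAlong φ j ω γ) (w : W) :
    ∃ p, j p = ∑ x : φ.ker, ω.act x w := by
  refine (h.mem_range _).2 fun x hx => ?_
  rw [map_sum, Finset.sum_mul]
  simp only [act_act]
  exact Fintype.sum_bijective (fun g => ⟨x, hx⟩ * g)
    (Group.mulLeft_bijective (⟨x, hx⟩ : φ.ker)) _ _ (fun _ => rfl)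

/-- Galois coordinates for Γ are also coordinates for the restriction to ker φ. -/
theorem exists_sum_ker_eq_one (φ : Γ →* G) [Fintype φ.ker]
    (hω : ω.IsPartialGalois) : ∃ c, ∑ x : φ.ker, ω.act x c = 1 := by
  obtain ⟨m, x, y, h1, h2⟩ := hω.exists_coordinates
  obtain ⟨c, hc⟩ := (ω.restrict φ.ker).exists_sum_act_eq_one ⟨m, x, y, by
    simpa only [restrict_act, Subgroup.coe_one] using h1, fun g hg => by
    simpa only [restrict_act] using h2 g (by simpa using hg)⟩
  exact ⟨c, by simpa only [restrict_act] using hc⟩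

/-- With traces over ker φ and tr(c) = 1, the new coordinates are tr(c x_i) and tr(y_i). The sum ∑
tr(c x_i) ω_a(tr(y_i)) collapses to the terms ω_b(c) 1_a with b = ad and b, d ∈ ker φ. For a = 1
these add up to tr(c) = 1; for φ a ≠ 1 there are none. -/
theorem isPartialGalois [Finite Γ] (h : IsQuotientAlong φ j ω γ) (hω : ω.IsPartialGalois) :
    γ.IsPartialGalois := by
  classical
  cases nonempty_fintype Γ
  obtain ⟨c, hc⟩ := exists_sum_ker_eq_one φ hω
  obtain ⟨m, x, y, h1, h2⟩ := hω.exists_coordinates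
  choose x' hx' using fun i => h.exists_eq_sum_ker (c * x i)
  choose y' hy' using fun i => h.exists_eq_sum_ker (y i)
  have key := sum_act_mul_act h1 h2
  have key' : ∀ a : Γ, ∑ i, j (x' i) * ω.act a (j (y' i)) =
      ∑ b : φ.ker, ∑ d : φ.ker, if (b : Γ) = a * d then ω.act b c * ω.one a else 0 := by
    intro a
    have : ∀ i, j (x' i) * ω.act a (j (y' i)) = ∑ b : φ.ker, ∑ d : φ.ker,
        ω.act b c * ω.one a * (ω.act b (x i) * ω.act (a * d) (y i)) := by
      intro i
      rw [hx', hy', map_sum, Finset.sum_mul_sum]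
      refine Finset.sum_congr rfl fun b _ => Finset.sum_congr rfl fun d _ => ?_
      rw [act_mul, act_act]
      ring
    simp only [this]
    rw [Finset.sum_comm]
    refine Finset.sum_congr rfl fun b _ => ?_
    rw [Finset.sum_comm]
    refine Finset.sum_congr rfl fun d _ => ?_
    rw [← Finset.mul_sum, key]
    split_ifs
    · linear_combination ω.one a * ω.act_mem b c
    · rw [mul_zero]
  refine ⟨?_, ?_, m, x', y', ?_, fun g hg => ?_⟩
  · intro r s hrs
    apply hω.injective
    rw [← j.commutes, hrs, j.commutes]
  · rw [eq_bot_iff]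
    intro p hp
    have h3 : j p ∈ ω.invariants := fun x => by
      rw [← h.act_mul_one, hp (φ x), map_mul, mul_assoc, h.one_mul_one]
    rw [hω.invariants_eq, Algebra.mem_bot] at h3
    obtain ⟨r, hr⟩ := h3
    rw [Algebra.mem_bot]
    exact ⟨r, h.injective (by rw [j.commutes, hr])⟩
  · apply h.injective
    simp only [map_sum, map_mul, _root_.map_one, act_one_apply]
    have h3 := key' 1
    simp only [act_one_apply, one_mul, Subtype.coe_inj, Finset.sum_ite_eq, Finset.mem_univ,
      if_true, one_one, mul_one, hc] at h3
    exact h3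
  · apply h.injective
    rw [map_zero]
    -- The sum lies in the ideal of g, so its vanishing may be tested on each 1_a with φ a = g.
    refine h.eq_of_mul_one (g := g) ?_ (zero_mul _) ?_
    · rw [← map_mul, Finset.sum_mul]
      simp only [mul_assoc, act_mem]
    · rintro a rfl
      simp only [map_sum, map_mul, Finset.sum_mul, mul_assoc, h.act_mul_one, zero_mul]
      rw [key']
      refine Finset.sum_eq_zero fun b _ => Finset.sum_eq_zero fun d _ => if_neg fun hbd => hg ?_
      have h3 := congrArg φ hbd
      rw [map_mul, b.2, d.2, mul_one] at h3
      exact h3.symm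

/-- Tensoring need not preserve injectivity or invariants. Here it does, because w ↦ tr(cw), the
trace being over ker φ, is a k-linear retraction of j and remains one after tensoring with S'. -/
theorem tensor_right {G' S' : Type*} [Group G'] [CommRing S'] [Algebra k S'] [Finite Γ]
    (h : IsQuotientAlong φ j ω γ) (hω : ω.IsPartialGalois) (α : UnitalPartialAction k G' S') :
    IsQuotientAlong (φ.prodMap (MonoidHom.id G')) (Algebra.TensorProduct.map j (AlgHom.id k S'))
      (ω.tensor α) (γ.tensor α) := by
  cases nonempty_fintype φ.ker
  obtain ⟨c, hc⟩ := exists_sum_ker_eq_one φ hω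
  choose r hr using fun w => h.exists_eq_sum_ker (c * w)
  let ρ : W →ₗ[k] P :=
    { toFun := r
      map_add' := fun a b => h.injective <| by
        simp only [map_add, hr, mul_add, Finset.sum_add_distrib]
      map_smul' := fun a b => h.injective <| by
        rw [RingHom.id_apply, map_smul, hr, hr, Finset.smul_sum]
        exact Finset.sum_congr rfl fun x _ => by rw [mul_smul_comm, map_smul] }
  have hρ : ∀ w, j (ρ w) = ∑ x : φ.ker, ω.act x (c * w) := hr
  have hρj : ∀ p, ρ (j p) = p := fun p => h.injective <| by
    rw [hρ]
    conv_rhs => rw [← one_mul (j p), ← hc, Finset.sum_mul]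
    refine Finset.sum_congr rfl fun x _ => ?_
    rw [act_mul, (h.mem_range (j p)).1 ⟨p, rfl⟩ x x.2]
    linear_combination j p * ω.act_mem x c
  have hjt : ∀ p s, Algebra.TensorProduct.map j (AlgHom.id k S') (p ⊗ₜ s) = j p ⊗ₜ s :=
    fun _ _ => rfl
  refine ⟨?_, fun w => ⟨?_, fun hw => ?_⟩, ?_, ?_⟩
  · refine Function.LeftInverse.injective (g := TensorProduct.map ρ LinearMap.id) fun t => ?_
    induction t using TensorProduct.induction_on with
    | zero => simp
    | add a b ha hb => rw [map_add, map_add, ha, hb]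
    | tmul a b => rw [hjt, TensorProduct.map_tmul, hρj, LinearMap.id_apply]
  · rintro ⟨t, rfl⟩ ⟨x, g⟩ hx
    have hx1 : φ x = 1 := congrArg Prod.fst hx
    have hx2 : g = 1 := congrArg Prod.snd hx
    subst hx2
    induction t using TensorProduct.induction_on with
    | zero => simp
    | add a b ha hb => rw [map_add, map_add, ha, hb, add_mul]
    | tmul a b =>
      rw [hjt, tensor_act_tmul, tensor_one, Algebra.TensorProduct.tmul_mul_tmul, act_one_apply,
        one_one, mul_one, (h.mem_range _).1 ⟨a, rfl⟩ x hx1]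
  · have h1 : ∀ w, Algebra.TensorProduct.map j (AlgHom.id k S')
        (TensorProduct.map ρ LinearMap.id w) =
        ∑ x : φ.ker, (ω.tensor α).act ((x : Γ), 1) (c ⊗ₜ 1 * w) := by
      intro w
      induction w using TensorProduct.induction_on with
      | zero => simp
      | add a b ha hb =>
        simp only [map_add, ha, hb, mul_add, Finset.sum_add_distrib]
      | tmul a b =>
        simp only [Algebra.TensorProduct.tmul_mul_tmul, tensor_act_tmul, one_mul, act_one_apply,
          ← TensorProduct.sum_tmul]
        rw [TensorProduct.map_tmul, hjt, hρ, LinearMap.id_apply]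
    refine ⟨_, (h1 w).trans ?_⟩
    -- The invariant w comes out of the trace, leaving tr(c) ⊗ 1 = 1 as its coefficient; hence w is
    -- in the image.
    have h2 : ∑ x : φ.ker, (ω.tensor α).act ((x : Γ), 1) (c ⊗ₜ 1 * w) =
        ∑ x : φ.ker, (ω.act x c ⊗ₜ 1) * w := by
      refine Finset.sum_congr rfl fun x _ => ?_
      have h3 := hw ((x : Γ), 1) (Prod.ext x.2 rfl)
      have h4 := (ω.tensor α).act_mem ((x : Γ), 1) (c ⊗ₜ 1)
      have h5 : (ω.tensor α).act ((x : Γ), 1) (c ⊗ₜ 1) = ω.act x c ⊗ₜ 1 := by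
        rw [tensor_act_tmul, act_one_apply]
      rw [act_mul, h3, ← h5]
      linear_combination w * h4
    rw [h2, ← Finset.sum_mul, ← TensorProduct.sum_tmul, hc, ← Algebra.TensorProduct.one_def, one_mul]
  · rintro ⟨x, g⟩ t
    induction t using TensorProduct.induction_on with
    | zero => simp
    | add a b ha hb => simp only [map_add, add_mul, ha, hb]
    | tmul a b =>
      rw [tensor_act_tmul, hjt, hjt, tensor_act_tmul, tensor_one,
        Algebra.TensorProduct.tmul_mul_tmul]
      exact congrArg₂ (· ⊗ₜ[k] ·) (h.act_mul_one x a) (α.act_mem g b)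
  · rintro ⟨g, g'⟩
    rw [tensor_one, hjt]
    have h1 : ∀ a ∈ Ideal.span (ω.one '' (φ ⁻¹' {g})), a ⊗ₜ[k] α.one g' ∈
        Ideal.span ((ω.tensor α).one '' (φ.prodMap (MonoidHom.id G') ⁻¹' {(g, g')})) := by
      intro a ha
      induction ha using Submodule.span_induction with
      | mem a ha =>
        obtain ⟨x, rfl, rfl⟩ := ha
        exact Ideal.subset_span ⟨(x, g'), rfl, rfl⟩
      | zero => rw [TensorProduct.zero_tmul]; exact Ideal.zero_mem _
      | add a b _ _ ha hb => rw [TensorProduct.add_tmul]; exact Ideal.add_mem _ ha hb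
      | smul c a _ ha =>
        have := Ideal.mul_mem_left _ (c ⊗ₜ[k] (1 : S')) ha
        rwa [Algebra.TensorProduct.tmul_mul_tmul, one_mul] at this
    exact h1 _ (h.one_mem g)

end IsQuotientAlong

/-! ### Tensor products of partial Galois extensions -/

section Tensor

variable {R G G' S S' : Type*} [CommRing R] [Group G] [Group G'] [CommRing S] [CommRing S']
  [Algebra R S] [Algebra R S']

/-- The element c ⊗ c' has trace one, and tr((c ⊗ c')t) lies in R because it does on pure tensors;
an invariant t equals this trace. Coordinates are the pairwise tensor products of the given ones. -/
theorem IsPartialGalois.tensor [Finite G] [Finite G'] {α : UnitalPartialAction R G S}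
    {α' : UnitalPartialAction R G' S'} (hα : α.IsPartialGalois) (hα' : α'.IsPartialGalois) :
    (α.tensor α').IsPartialGalois := by
  classical
  cases nonempty_fintype G
  cases nonempty_fintype G'
  obtain ⟨c, hc⟩ := α.exists_sum_act_eq_one hα.exists_coordinates
  obtain ⟨c', hc'⟩ := α'.exists_sum_act_eq_one hα'.exists_coordinates
  have tr_mul : ∀ t, ∃ r : R, algebraMap R (S ⊗[R] S') r =
      ∑ g, (α.tensor α').act g (c ⊗ₜ c' * t) := by
    intro t
    induction t using TensorProduct.induction_on with
    | zero => exact ⟨0, by simp⟩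
    | add a b ha hb =>
      obtain ⟨r, hr⟩ := ha
      obtain ⟨s, hs⟩ := hb
      exact ⟨r + s, by rw [map_add, hr, hs]; simp only [mul_add, map_add, Finset.sum_add_distrib]⟩
    | tmul a b =>
      obtain ⟨r, hr⟩ := hα.trace_mem (c * a)
      obtain ⟨s, hs⟩ := hα'.trace_mem (c' * b)
      refine ⟨r * s, ?_⟩
      simp only [Algebra.TensorProduct.tmul_mul_tmul, tensor_act_tmul]
      rw [Fintype.sum_prod_type]
      simp only [← TensorProduct.tmul_sum, ← TensorProduct.sum_tmul]
      rw [← hr, ← hs, map_mul, Algebra.TensorProduct.algebraMap_apply,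
        Algebra.TensorProduct.algebraMap_apply' s, Algebra.TensorProduct.tmul_mul_tmul, one_mul,
        mul_one]
  have tr_one : ∑ g, (α.tensor α').act g (c ⊗ₜ c') = 1 := by
    simp only [tensor_act_tmul]
    rw [Fintype.sum_prod_type]
    simp only [← TensorProduct.tmul_sum, ← TensorProduct.sum_tmul, hc, hc']
    rfl
  refine ⟨?_, ?_, ?_⟩
  · rw [injective_iff_map_eq_zero]
    intro r hr
    have h1 : r • ((1 : S) ⊗ₜ[R] (1 : S')) = 0 := by
      rw [← Algebra.TensorProduct.one_def, ← Algebra.algebraMap_eq_smul_one, hr]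
    choose ρ hρ using fun s => hα.trace_mem (c * s)
    -- The map s ↦ tr(cs) splits R → S, so r(1 ⊗ 1) = 0 forces r · 1 = 0 in S'.
    let L : S →ₗ[R] R :=
      { toFun := ρ
        map_add' := fun a b => hα.injective <| by
          simp only [map_add, hρ, mul_add, Finset.sum_add_distrib]
        map_smul' := fun a b => hα.injective <| by
          simp only [RingHom.id_apply, smul_eq_mul, map_mul, hρ, mul_smul_comm, map_smul,
            ← Algebra.smul_def, Finset.smul_sum] }
    have hL : L 1 = 1 := hα.injective <| by
      change algebraMap R S (ρ 1) = _
      rw [hρ, mul_one, hc, _root_.map_one]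
    have h2 := congrArg (TensorProduct.lid R S' ∘ₗ TensorProduct.map L LinearMap.id :
      S ⊗[R] S' →ₗ[R] S') h1
    rw [map_smul, map_zero, LinearMap.comp_apply, TensorProduct.map_tmul, hL] at h2
    apply hα'.injective
    rw [map_zero, Algebra.algebraMap_eq_smul_one]
    simpa using h2
  · rw [eq_bot_iff]
    intro t ht
    rw [Algebra.mem_bot]
    obtain ⟨r, hr⟩ := tr_mul t
    refine ⟨r, hr.trans ?_⟩
    conv_rhs => rw [← one_mul t, ← tr_one, Finset.sum_mul]
    refine Finset.sum_congr rfl fun g _ => ?_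
    rw [act_mul, ht g]
    linear_combination t * (α.tensor α').act_mem g (c ⊗ₜ c')
  · obtain ⟨m, x, y, h1, h2⟩ := hα.exists_coordinates
    obtain ⟨n, x', y', h1', h2'⟩ := hα'.exists_coordinates
    have key : ∀ g : G × G', ∑ i, x (finProdFinEquiv.symm i).1 ⊗ₜ[R] x' (finProdFinEquiv.symm i).2 *
        (α.tensor α').act g (y (finProdFinEquiv.symm i).1 ⊗ₜ[R] y' (finProdFinEquiv.symm i).2) =
        (∑ i, x i * α.act g.1 (y i)) ⊗ₜ (∑ i, x' i * α'.act g.2 (y' i)) := by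
      intro g
      rw [Equiv.sum_comp finProdFinEquiv.symm (fun i => x i.1 ⊗ₜ[R] x' i.2 *
        (α.tensor α').act g (y i.1 ⊗ₜ[R] y' i.2)), Fintype.sum_prod_type]
      simp only [tensor_act_tmul, Algebra.TensorProduct.tmul_mul_tmul, TensorProduct.sum_tmul,
        TensorProduct.tmul_sum]
      rw [Finset.sum_comm]
    refine ⟨m * n, _, _, (key 1).trans ?_, fun g hg => (key g).trans ?_⟩
    · rw [Prod.fst_one, Prod.snd_one, h1, h1']
      rfl
    · by_cases h3 : g.1 = 1
      · rw [h2' _ fun h4 => hg (Prod.ext h3 h4), TensorProduct.tmul_zero]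
      · rw [h2 _ h3, TensorProduct.zero_tmul]

end Tensor

end UnitalPartialAction

namespace UnitalPartialAction

/-! ### Existence of a globalization -/

section Globalization

variable {k : Type*} {G : Type v} {S : Type u} [CommRing k] [Group G] [CommRing S] [Algebra k S]
  (α : UnitalPartialAction k G S)

/-- The functions `f : G → S` with `α_g (f h 1_{g⁻¹}) = f (g h) 1_g`, which form a globalization. -/
def envelope : Subalgebra k (G → S) where
  carrier := {f | ∀ g h, α.act g (f h) = f (g * h) * α.one g}
  mul_mem' {a b} ha hb g h := by
    rw [Pi.mul_apply, Pi.mul_apply, act_mul, ha, hb]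
    linear_combination a (g * h) * b (g * h) * α.one_idem g
  add_mem' {a b} ha hb g h := by rw [Pi.add_apply, Pi.add_apply, map_add, ha, hb, add_mul]
  algebraMap_mem' c g h := by
    rw [Pi.algebraMap_apply, Pi.algebraMap_apply, Algebra.algebraMap_eq_smul_one, map_smul,
      act_one, smul_mul_assoc, one_mul]

/-- Translation on the envelope. -/
def envelopeMap (g : G) : α.envelope →ₐ[k] α.envelope where
  toFun f := ⟨fun h => f.1 (h * g), fun a b => (f.2 a (b * g)).trans (by simp only [mul_assoc])⟩
  map_one' := rfl
  map_mul' _ _ := rfl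
  map_zero' := rfl
  map_add' _ _ := rfl
  commutes' _ := rfl

/-- The global action by translation on the envelope. -/
def envelopeAction : G →* (α.envelope ≃ₐ[k] α.envelope) where
  toFun g := AlgEquiv.ofAlgHom (α.envelopeMap g) (α.envelopeMap g⁻¹)
    (AlgHom.ext fun f => Subtype.ext <| funext fun h => congrArg f.1 (mul_inv_cancel_right h g))
    (AlgHom.ext fun f => Subtype.ext <| funext fun h => congrArg f.1 (inv_mul_cancel_right h g))
  map_one' := AlgEquiv.ext fun f => Subtype.ext <| funext fun h => congrArg f.1 (mul_one h)
  map_mul' a b := AlgEquiv.ext fun f => Subtype.ext <| funext fun h =>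
    congrArg f.1 (mul_assoc h a b).symm

/-- The embedding of `S` in the envelope. -/
def toEnvelope : S →ₙₐ[k] α.envelope where
  toFun s := ⟨fun h => α.act h s, fun g h => α.act_act g h s⟩
  map_smul' c s := Subtype.ext <| funext fun h => map_smul (α.act h) c s
  map_zero' := Subtype.ext <| funext fun h => map_zero (α.act h)
  map_add' s t := Subtype.ext <| funext fun h => map_add (α.act h) s t
  map_mul' s t := Subtype.ext <| funext fun h => α.act_mul h s t

theorem toEnvelope_apply (s : S) (h : G) : (α.toEnvelope s).1 h = α.act h s := rfl

theorem envelopeAction_apply (g : G) (f : α.envelope) (h : G) :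
    (α.envelopeAction g f).1 h = f.1 (h * g) := rfl

theorem mul_toEnvelope (f : α.envelope) (s : S) :
    f * α.toEnvelope s = α.toEnvelope (f.1 1 * s) := by
  refine Subtype.ext <| funext fun h => ?_
  change f.1 h * α.act h s = α.act h (f.1 1 * s)
  rw [act_mul, f.2, mul_one]
  linear_combination (-f.1 h) * α.act_mem h s

/-- A unital partial action of a finite group has a globalization. -/
def globalization [Finite G] : PartialAction.Globalization.{max u v} α.toPartialAction where
  T := α.envelope
  β := α.envelopeAction
  ι := α.toEnvelope
  injective s t hst := by
    have := congrFun (congrArg Subtype.val hst) 1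
    simpa only [toEnvelope_apply, act_one_apply] using this
  isIdeal f s := ⟨_, (α.mul_toEnvelope f s).symm⟩
  image_ideal g := by
    ext f
    constructor
    · rintro ⟨x, hx, rfl⟩
      refine ⟨⟨x, rfl⟩, _, ⟨α.act g⁻¹ x, rfl⟩, ?_⟩
      refine Subtype.ext <| funext fun h => ?_
      rw [envelopeAction_apply, toEnvelope_apply, toEnvelope_apply, act_act,
        mul_inv_cancel_right]
      conv_rhs => rw [← α.mem_ideal.1 hx, act_mul, act_one_mul]
      linear_combination (-α.one (h * g)) * α.act_mem h x
    · rintro ⟨⟨x, rfl⟩, _, ⟨y, rfl⟩, hxy⟩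
      refine ⟨x, ?_, rfl⟩
      have := congrFun (congrArg Subtype.val hxy) 1
      rw [envelopeAction_apply, toEnvelope_apply, toEnvelope_apply, act_one_apply, one_mul] at this
      exact α.mem_ideal.2 (by rw [← this, act_mem])
  extends_map g x := by
    refine Subtype.ext <| funext fun h => ?_
    rw [envelopeAction_apply, toEnvelope_apply, toEnvelope_apply, ← act_coe, act_act]
    have h1 := α.act_mul (h * g) x (α.one g⁻¹)
    rw [α.mem_ideal.1 x.2, act_one_mul, mul_inv_cancel_right] at h1
    linear_combination h1 + α.one h * α.act_mem (h * g) (x : S)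
  span_eq_top := by
    classical
    cases nonempty_fintype G
    let N := Submodule.span k (⋃ g : G, α.envelopeAction g '' Set.range α.toEnvelope)
    have hN : ∀ f, f ∈ N → ∀ f', f' * f ∈ N := by
      intro f hf f'
      induction hf using Submodule.span_induction with
      | mem f hf =>
        obtain ⟨g, hf⟩ := Set.mem_iUnion.1 hf
        obtain ⟨_, ⟨s, rfl⟩, rfl⟩ := hf
        refine Submodule.subset_span (Set.mem_iUnion.2
          ⟨g, _, ⟨((α.envelopeAction g).symm f').1 1 * s, rfl⟩, ?_⟩)
        rw [← mul_toEnvelope, map_mul, AlgEquiv.apply_symm_apply]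
      | zero => rw [mul_zero]; exact zero_mem N
      | add a b _ _ ha hb => rw [mul_add]; exact add_mem ha hb
      | smul c a _ ha => rw [mul_smul_comm]; exact N.smul_mem c ha
    have h1 : ∀ g, α.envelopeAction g (α.toEnvelope 1) ∈ N := fun g =>
      Submodule.subset_span (Set.mem_iUnion.2 ⟨g, _, ⟨1, rfl⟩, rfl⟩)
    have h2 : ∀ s : Finset G, 1 - ∏ g ∈ s, (1 - α.envelopeAction g (α.toEnvelope 1)) ∈ N := by
      intro s
      induction s using Finset.induction_on with
      | empty => simp
      | insert g s hg ih =>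
        rw [Finset.prod_insert hg]
        have : 1 - (1 - α.envelopeAction g (α.toEnvelope 1)) *
            ∏ g ∈ s, (1 - α.envelopeAction g (α.toEnvelope 1)) =
            (1 - ∏ g ∈ s, (1 - α.envelopeAction g (α.toEnvelope 1))) +
            (∏ g ∈ s, (1 - α.envelopeAction g (α.toEnvelope 1))) *
              α.envelopeAction g (α.toEnvelope 1) := by ring
        rw [this]
        exact add_mem ih (hN _ (h1 g) _)
    -- At the coordinate h the factor of g = h⁻¹ vanishes. With `h2` this puts 1 in the ideal N.
    have h3 : ∏ g, (1 - α.envelopeAction g (α.toEnvelope 1)) = 0 := by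
      refine Subtype.ext <| funext fun h => ?_
      have h4 : ((∏ g, (1 - α.envelopeAction g (α.toEnvelope 1)) : α.envelope) : G → S) =
          ∏ g, ((1 - α.envelopeAction g (α.toEnvelope 1) : α.envelope) : G → S) :=
        map_prod α.envelope.val _ _
      rw [h4, Finset.prod_apply]
      refine Finset.prod_eq_zero (Finset.mem_univ h⁻¹) ?_
      change 1 - α.act (h * h⁻¹) 1 = 0
      rw [mul_inv_cancel, act_one_apply, sub_self]
    refine eq_top_iff.2 fun f _ => ?_
    have h5 := hN _ (h2 Finset.univ) f
    rwa [h3, sub_zero, mul_one] at h5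

end Globalization

end UnitalPartialAction

/-! ### The quotient action read off from an arbitrary globalization -/

namespace PartialAction.Globalization

variable {k G S : Type*} [CommRing k] [Group G] [CommRing S] [Algebra k S]
  {α : UnitalPartialAction k G S} (Γ : PartialAction.Globalization.{w} α.toPartialAction)

/-- Both sides are identity elements of the ideal S ∩ β_g(S). -/
theorem ι_one (g : G) : Γ.ι (α.one g) = Γ.ι 1 * Γ.β g (Γ.ι 1) := by
  have h1 : Γ.ι 1 * Γ.β g (Γ.ι 1) ∈ Γ.ι '' (α.ideal g) := by
    rw [Γ.image_ideal]
    constructor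
    · rw [mul_comm]
      exact Γ.isIdeal _ _
    · obtain ⟨s, hs⟩ := Γ.isIdeal ((Γ.β g).symm (Γ.ι 1)) 1
      exact ⟨_, ⟨s, rfl⟩, by rw [hs, _root_.map_mul, AlgEquiv.apply_symm_apply]⟩
  obtain ⟨z, hz, hz'⟩ := h1
  have h2 : Γ.ι (α.one g) ∈ Γ.ι '' (α.ideal g) := ⟨_, α.mem_ideal.2 (α.one_idem g), rfl⟩
  rw [Γ.image_ideal] at h2
  obtain ⟨-, _, ⟨y, rfl⟩, hy⟩ := h2
  have h3 : Γ.ι (α.one g) * Γ.β g (Γ.ι 1) = Γ.ι (α.one g) := by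
    rw [← hy, ← _root_.map_mul, ← _root_.map_mul, mul_one]
  have h4 : Γ.ι (α.one g) * Γ.ι 1 = Γ.ι (α.one g) := by rw [← _root_.map_mul, mul_one]
  rw [← hz', ← α.mem_ideal.1 hz, mul_comm z, _root_.map_mul, hz', ← mul_assoc, h4, h3]

theorem β_ι_mul_ι_one (g : G) (s : S) : Γ.β g (Γ.ι s) * Γ.ι 1 = Γ.ι (α.act g s) := by
  rw [α.act_def, ← Γ.extends_map]
  simp only
  rw [_root_.map_mul, ι_one, ← mul_assoc, ← _root_.map_mul Γ.ι, mul_one, _root_.map_mul,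
    ← AlgEquiv.mul_apply, ← _root_.map_mul, mul_inv_cancel, _root_.map_one Γ.β,
    AlgEquiv.one_apply]

end PartialAction.Globalization

namespace UnitalPartialAction

section Quotient

variable {k G S : Type*} [CommRing k] [Group G] [CommRing S] [Algebra k S]
  (α : UnitalPartialAction k G S) {H : Subgroup G}

/-- For `H = {h_0, …, h_m}`, the map `s ↦ ∑_i α_{g h_i}(s) ∏_{j < i} (1 - 1_{g h_j})`. -/
def cosetAct {m : ℕ} (h : Fin (m + 1) ≃ H) (g : G) : S →ₗ[k] S :=
  ∑ i, LinearMap.mulRight k (∏ j ∈ Finset.Iio i, (1 - α.one (g * h j))) ∘ₗ α.act (g * h i)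

theorem cosetAct_apply {m : ℕ} (h : Fin (m + 1) ≃ H) (g : G) (s : S) :
    α.cosetAct h g s =
      ∑ i, α.act (g * h i) s * ∏ j ∈ Finset.Iio i, (1 - α.one (g * h j)) := by
  simp [cosetAct]

/-- Cutting by 1_S turns β_{gh_i}(s) into α_{gh_i}(s) and β_{gh_j}(1_S) into 1_{gh_j}. The
right-hand side no longer involves the globalization except through ι. -/
theorem β_psi_mul_ι_one (Γ : PartialAction.Globalization.{w} α.toPartialAction) {m : ℕ}
    (h : Fin (m + 1) ≃ H) (g : G) (s : S) :
    Γ.β g (Γ.psi h (Γ.ι s)) * Γ.ι 1 = Γ.ι (α.cosetAct h g s) := by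
  have h1 : ∀ (t : Finset (Fin (m + 1))) (a : S),
      Γ.ι a * ∏ j ∈ t, (1 - Γ.β (g * h j) (Γ.ι 1)) = Γ.ι (a * ∏ j ∈ t, (1 - α.one (g * h j))) := by
    intro t a
    induction t using Finset.induction_on with
    | empty => simp
    | insert j t hj ih =>
      rw [Finset.prod_insert hj, Finset.prod_insert hj, mul_left_comm, ih, mul_left_comm a, mul_comm,
        mul_comm (1 - α.one _), mul_sub, mul_sub, mul_one, mul_one, map_sub, map_mul _ _ (α.one _),
        Γ.ι_one, ← mul_assoc, ← map_mul Γ.ι _ 1, mul_one]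
  rw [cosetAct_apply, PartialAction.Globalization.psi, map_sum, map_sum, Finset.sum_mul]
  refine Finset.sum_congr rfl fun i _ => ?_
  rw [PartialAction.Globalization.e, ← h1, ← Γ.β_ι_mul_ι_one, map_mul, map_mul, map_prod, map_mul,
    AlgEquiv.mul_apply]
  simp only [map_sub, map_one, map_mul, AlgEquiv.mul_apply]
  -- The last factor of e_i is absorbed by β_{h_i}(s).
  have h2 : Γ.β g (Γ.β (h i) (Γ.ι s)) * Γ.β g (Γ.β (h i) (Γ.ι 1)) = Γ.β g (Γ.β (h i) (Γ.ι s)) := by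
    rw [← map_mul, ← map_mul, ← map_mul, mul_one]
  linear_combination (Γ.ι 1 * ∏ j ∈ Finset.Iio i, (1 - Γ.β g (Γ.β (h j) (Γ.ι 1)))) * h2

/-- As h_0 = 1, every term with i > 0 contains the factor 1 - 1_{h_0} = 0. -/
theorem cosetAct_one_one {m : ℕ} (h : Fin (m + 1) ≃ H) (h0 : h 0 = 1) :
    α.cosetAct h 1 1 = 1 := by
  rw [cosetAct_apply, Finset.sum_eq_single 0]
  · rw [h0]
    have : Finset.Iio (0 : Fin (m + 1)) = ∅ := by
      ext i; simp
    rw [this]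
    simp [act_one, one_one]
  · intro i _ hi
    rw [Finset.prod_eq_zero (i := 0), mul_zero]
    · simpa using Fin.pos_iff_ne_zero.2 hi
    · rw [h0]
      simp [one_one]
  · simp

/-- Since e_H 1_S = 1_S, the first factor has no effect. -/
theorem psi_mul_β_psi_mul_ι_one (Γ : PartialAction.Globalization.{w} α.toPartialAction) {m : ℕ}
    (h : Fin (m + 1) ≃ H) (h0 : h 0 = 1) (g : G) :
    Γ.psi h (Γ.ι 1) * Γ.β g (Γ.psi h (Γ.ι 1)) * Γ.ι 1 = Γ.ι (α.cosetAct h g 1) := by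
  have h1 := α.β_psi_mul_ι_one Γ h 1 1
  rw [cosetAct_one_one _ _ h0, map_one, AlgEquiv.one_apply] at h1
  have h2 : Γ.ι (α.cosetAct h g 1) * Γ.ι 1 = Γ.ι (α.cosetAct h g 1) := by rw [← map_mul, mul_one]
  rw [mul_assoc, α.β_psi_mul_ι_one, ← h2, mul_left_comm, h1]

/-- Invariance of s gives α_{gh_i}(s) 1_x = α_x(s) 1_{gh_i}. The remaining sum ∑ 1_{gh_i} ∏_{j<i} (1
- 1_{gh_j}) telescopes to 1 - ∏ (1 - 1_{gh_i}), and the product is killed by 1_x because x is one of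
the gh_i. -/
theorem cosetAct_mul_one {m : ℕ} (h : Fin (m + 1) ≃ H) (g x : G)
    (hx : (x : G ⧸ H) = g) {s : S} (hs : s ∈ (α.restrict H).invariants) :
    α.cosetAct h g s * α.one x = α.act x s := by
  rw [mem_restrict_invariants] at hs
  have hx' : g⁻¹ * x ∈ H := QuotientGroup.eq.1 hx.symm
  have h1 : ∀ i, α.act (g * h i) s * α.one x = α.act x s * α.one (g * h i) := by
    intro i
    have h2 : x⁻¹ * (g * h i) ∈ H := by
      have := H.mul_mem (H.inv_mem hx') (h i).2
      simpa [mul_assoc] using this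
    have h3 := α.act_act x (x⁻¹ * (g * h i)) s
    rw [hs _ h2, act_mul, act_one_mul, mul_inv_cancel_left] at h3
    rw [← h3, ← mul_assoc, act_mem]
  have h4 := Finset.prod_one_sub_ordered Finset.univ fun i => α.one (g * h i)
  have h5 : α.act x s * ∏ i, (1 - α.one (g * h i)) = 0 := by
    obtain ⟨i, hi⟩ := h.surjective ⟨g⁻¹ * x, hx'⟩
    rw [← Finset.mul_prod_erase _ _ (Finset.mem_univ i), hi, mul_inv_cancel_left, ← mul_assoc,
      mul_sub, act_mem, mul_one, sub_self, zero_mul]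
  rw [cosetAct_apply, Finset.sum_mul]
  have h6 : ∀ i, α.act (g * h i) s * (∏ j ∈ Finset.Iio i, (1 - α.one (g * h j))) * α.one x =
      α.act x s * (α.one (g * h i) * ∏ j with j < i, (1 - α.one (g * h j))) := by
    intro i
    have : (Finset.univ.filter (· < i)) = Finset.Iio i := by ext; simp
    rw [this]
    linear_combination (∏ j ∈ Finset.Iio i, (1 - α.one (g * h j))) * h1 i
  simp only [h6]
  rw [← Finset.mul_sum]
  rw [h4] at h5
  linear_combination -h5

theorem cosetAct_mem {m : ℕ} (h : Fin (m + 1) ≃ H) [H.Normal] (g : G) (s : S) :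
    α.cosetAct h g s ∈ Ideal.span (α.one '' (QuotientGroup.mk' H ⁻¹' {(g : G ⧸ H)})) := by
  rw [cosetAct_apply]
  refine Ideal.sum_mem _ fun i _ => Ideal.mul_mem_right _ _ ?_
  rw [← act_mem]
  refine Ideal.mul_mem_left _ _ (Ideal.subset_span ⟨_, ?_, rfl⟩)
  exact QuotientGroup.mk_mul_of_mem g (h i).2

end Quotient

end UnitalPartialAction

namespace UnitalPartialAction

/-! ### Construction and characterisation of the quotient action -/

section Quotient

variable {k G S : Type*} [CommRing k] [Group G] [CommRing S] [Algebra k S]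
  (α : UnitalPartialAction k G S) {H : Subgroup G} [H.Normal]

/-- The ideal generated by the idempotents `1_x` with `x` in a coset. -/
def cosetIdeal (H : Subgroup G) [H.Normal] (q : G ⧸ H) : Ideal S :=
  Ideal.span (α.one '' (QuotientGroup.mk' H ⁻¹' {q}))

theorem act_mem_cosetIdeal (x : G) {q : G ⧸ H} {s : S} (hs : s ∈ α.cosetIdeal H q) :
    α.act x s ∈ α.cosetIdeal H (x * q) := by
  induction hs using Submodule.span_induction with
  | mem s hs =>
    obtain ⟨y, rfl, rfl⟩ := hs
    rw [act_one_mul]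
    exact Ideal.mul_mem_left _ _ (Ideal.subset_span ⟨_, rfl, rfl⟩)
  | zero => rw [map_zero]; exact Ideal.zero_mem _
  | add a b _ _ ha hb => rw [map_add]; exact Ideal.add_mem _ ha hb
  | smul c a _ ha => rw [smul_eq_mul, act_mul]; exact Ideal.mul_mem_left _ _ ha

/-- The value of `cosetAct` at 1 lies in the coset ideal and fixes each of its generators, so it is
an identity element there. -/
theorem eq_of_mem_cosetIdeal [Finite H] {q : G ⧸ H} {a b : S} (ha : a ∈ α.cosetIdeal H q)
    (hb : b ∈ α.cosetIdeal H q)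
    (hab : ∀ x : G, (x : G ⧸ H) = q → a * α.one x = b * α.one x) : a = b := by
  obtain ⟨n, ⟨e⟩⟩ := Finite.exists_equiv_fin H
  obtain _ | m := n
  · exact (e 1).elim0
  obtain ⟨g, rfl⟩ := QuotientGroup.mk_surjective q
  have h1 : ∀ c ∈ α.cosetIdeal H (g : G ⧸ H), α.cosetAct e.symm g 1 * c = c := by
    intro c hc
    induction hc using Submodule.span_induction with
    | mem s hs =>
      obtain ⟨y, hy, rfl⟩ := hs
      rw [α.cosetAct_mul_one e.symm g y hy (one_mem _), act_one]
    | zero => rw [mul_zero]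
    | add a b _ _ ha hb => rw [mul_add, ha, hb]
    | smul c a _ ha => rw [smul_eq_mul, mul_left_comm, ha]
  have h2 : ∀ c ∈ α.cosetIdeal H (g : G ⧸ H), (a - b) * c = 0 := by
    intro c hc
    induction hc using Submodule.span_induction with
    | mem s hs =>
      obtain ⟨y, hy, rfl⟩ := hs
      rw [sub_mul, hab y hy, sub_self]
    | zero => rw [mul_zero]
    | add a b _ _ ha hb => rw [mul_add, ha, hb, add_zero]
    | smul c a _ ha => rw [smul_eq_mul, mul_left_comm, ha, mul_zero]
  rw [← sub_eq_zero, ← h1 _ (Ideal.sub_mem _ ha hb), mul_comm]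
  exact h2 _ (α.cosetAct_mem e.symm g 1)

/-- For x ∈ H both sides of the invariance equation lie in the ideal of gH. To compare them on 1_y
with y ∈ gH, apply α_x to the relation at x⁻¹y, which is again in gH by normality. -/
theorem cosetAct_mem_invariants [Finite H] {m : ℕ} (h : Fin (m + 1) ≃ H) (g : G) {s : S}
    (hs : s ∈ (α.restrict H).invariants) : α.cosetAct h g s ∈ (α.restrict H).invariants := by
  rw [mem_restrict_invariants]
  intro x hx
  have h1 := α.act_mem_cosetIdeal x (α.cosetAct_mem h g s)
  rw [(QuotientGroup.eq_one_iff x).2 hx, one_mul] at h1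
  refine α.eq_of_mem_cosetIdeal h1 (Ideal.mul_mem_right _ _ (α.cosetAct_mem h g s))
    fun y hy => ?_
  have hy' : ((x⁻¹ * y : G) : G ⧸ H) = g := by
    rw [QuotientGroup.mk_mul, QuotientGroup.mk_inv, (QuotientGroup.eq_one_iff x).2 hx, hy, inv_one,
      one_mul]
  have h2 := congrArg (α.act x) (α.cosetAct_mul_one h g _ hy' hs)
  rw [act_mul, act_one_mul, act_act, mul_inv_cancel_left] at h2
  have h3 := α.cosetAct_mul_one h g _ hy hs
  linear_combination h2 - h3 * α.one x - α.one y * α.act_mem x (α.cosetAct h g s)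

/-- The action of the class of `g` on the invariants of `H`. -/
def cosetActInvariants [Finite H] {m : ℕ} (h : Fin (m + 1) ≃ H) (g : G) :
    (α.restrict H).invariants →ₗ[k] (α.restrict H).invariants where
  toFun s := ⟨α.cosetAct h g s, α.cosetAct_mem_invariants h g s.2⟩
  map_add' s t := Subtype.ext (map_add (α.cosetAct h g) (s : S) t)
  map_smul' c s := Subtype.ext (map_smul (α.cosetAct h g) c (s : S))

/-- A coset acts by `cosetAct` at a chosen representative. Each axiom is an equality in a coset
ideal, hence can be tested on the 1_x, where `cosetAct` becomes α_x. -/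
theorem exists_isQuotientAlong_mk [Finite H] :
    ∃ γ : UnitalPartialAction k (G ⧸ H) (α.restrict H).invariants,
      IsQuotientAlong (QuotientGroup.mk' H) (α.restrict H).invariants.val α γ := by
  obtain ⟨n, ⟨e⟩⟩ := Finite.exists_equiv_fin H
  obtain _ | m := n
  · exact (e 1).elim0
  let h := e.symm
  have hmem : ∀ (q : G ⧸ H) s, α.cosetAct h q.out s ∈ α.cosetIdeal H q := fun q s => by
    have := α.cosetAct_mem h q.out s
    rwa [QuotientGroup.out_eq'] at this
  have hmul : ∀ (q : G ⧸ H) s, s ∈ (α.restrict H).invariants → ∀ x : G, (x : G ⧸ H) = q →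
      α.cosetAct h q.out s * α.one x = α.act x s := fun q s hs x hx =>
    α.cosetAct_mul_one h q.out x (by rw [hx, QuotientGroup.out_eq']) hs
  have hinv : ∀ (q : G ⧸ H) s, s ∈ (α.restrict H).invariants →
      α.cosetAct h (Quotient.out q) s ∈ (α.restrict H).invariants := fun q s hs =>
    α.cosetAct_mem_invariants h _ hs
  refine ⟨ofAct (fun q => α.cosetActInvariants h q.out 1)
    (fun q => α.cosetActInvariants h q.out) ?_ (fun _ => rfl) ?_ ?_, ?_⟩
  · intro q s t
    refine Subtype.ext (α.eq_of_mem_cosetIdeal (q := q) (hmem _ _)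
      (Ideal.mul_mem_left _ _ (hmem _ _)) fun x hx => ?_)
    have h1 := hmul q _ s.2 x hx
    have h2 := hmul q _ t.2 x hx
    have h3 := hmul q _ (s * t).2 x hx
    refine h3.trans ((α.act_mul x s t).trans ?_)
    rw [← h1, ← h2]
    change _ = α.cosetAct h q.out s * α.cosetAct h q.out t * α.one x
    linear_combination α.cosetAct h q.out s * α.cosetAct h q.out t * α.one_idem x
  · intro s
    refine Subtype.ext (α.eq_of_mem_cosetIdeal (q := (1 : G ⧸ H)) (hmem _ _) ?_ fun x hx => ?_)
    · rw [← mul_one (s : S), ← α.one_one]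
      exact Ideal.mul_mem_left _ _ (Ideal.subset_span ⟨1, rfl, rfl⟩)
    · refine (hmul 1 s s.2 x hx).trans ?_
      exact (α.mem_restrict_invariants H).1 s.2 x ((QuotientGroup.eq_one_iff x).1 hx)
  · intro p q s
    refine Subtype.ext (α.eq_of_mem_cosetIdeal (q := p) (hmem _ _)
      (Ideal.mul_mem_left _ _ (hmem _ _)) fun x hx => ?_)
    refine (hmul p _ (hinv q s s.2) x hx).trans ?_
    change _ = α.cosetAct h (p * q).out s * α.cosetAct h p.out 1 * α.one x
    rw [mul_assoc, hmul p 1 (one_mem _) x hx, act_one]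
    -- After restriction to 1_x with x ∈ p, both sides lie in the ideal of pq and are tested once
    -- more, on 1_y with y ∈ pq.
    have h1 := α.act_mem_cosetIdeal x (hmem q s)
    rw [hx] at h1
    refine α.eq_of_mem_cosetIdeal h1 (Ideal.mul_mem_right _ _ (hmem _ _)) fun y hy => ?_
    have h2 := congrArg (α.act x) (hmul q s s.2 (x⁻¹ * y) (by
      rw [QuotientGroup.mk_mul, QuotientGroup.mk_inv, hx, hy, inv_mul_cancel_left]))
    rw [act_mul, act_one_mul, act_act, mul_inv_cancel_left] at h2
    have h3 := hmul (p * q) s s.2 y hy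
    linear_combination h2 - h3 * α.one x -
      α.one y * α.act_mem x (α.cosetAct h (Quotient.out q) s)
  · refine ⟨Subtype.val_injective, fun w => ?_, fun x p => ?_, fun q => hmem q 1⟩
    · rw [Subalgebra.coe_val, Subtype.range_coe]
      refine (α.mem_restrict_invariants H).trans (forall_congr' fun x => ?_)
      rw [QuotientGroup.mk'_apply, QuotientGroup.eq_one_iff]
    · rw [ofAct_act]
      exact hmul x p p.2 x rfl

theorem IsQuotientAlong.val_act_eq_cosetAct [Finite H]
    {γ : UnitalPartialAction k (G ⧸ H) (α.restrict H).invariants}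
    (hγ : IsQuotientAlong (QuotientGroup.mk' H) (α.restrict H).invariants.val α γ)
    {m : ℕ} (h : Fin (m + 1) ≃ H) (g : G) (s : (α.restrict H).invariants) :
    (γ.act (g : G ⧸ H) s : S) = α.cosetAct h g s := by
  refine α.eq_of_mem_cosetIdeal (q := (g : G ⧸ H)) ?_ (α.cosetAct_mem h g s) fun x hx => ?_
  · rw [← act_mem]
    exact Ideal.mul_mem_left _ _ (hγ.one_mem _)
  · rw [α.cosetAct_mul_one h g x hx s.2, ← hx]
    exact hγ.act_mul_one x s

end Quotient

/-- The right-hand side mentions neither a globalization nor an enumeration, so this contains the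
independence of both. -/
theorem isQuotient_iff {k : Type*} {G : Type v} {S : Type u} [CommRing k] [Group G] [CommRing S]
    [Algebra k S] [Finite G] (α : UnitalPartialAction k G S) (H : Subgroup G) [H.Normal]
    (γ : UnitalPartialAction k (G ⧸ H) (α.restrict H).invariants) :
    α.IsQuotient H γ ↔
      IsQuotientAlong (QuotientGroup.mk' H) (α.restrict H).invariants.val α γ := by
  constructor
  · rintro ⟨Γ, m, h, h0, hΓ⟩
    have h1 : ∀ g : G, (γ.one (g : G ⧸ H) : S) = α.cosetAct h g 1 := fun g => by
      apply Γ.injective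
      rw [(hΓ g).1, α.psi_mul_β_psi_mul_ι_one Γ h h0]
    refine ⟨Subtype.val_injective, fun w => ?_, fun x p => ?_, fun q => ?_⟩
    · rw [Subalgebra.coe_val, Subtype.range_coe]
      refine (α.mem_restrict_invariants H).trans (forall_congr' fun x => ?_)
      rw [QuotientGroup.mk'_apply, QuotientGroup.eq_one_iff]
    · have h2 : (γ.act (x : G ⧸ H) p : S) = α.cosetAct h x (p * γ.one (x : G ⧸ H)⁻¹ : S) := by
        apply Γ.injective
        rw [act_def, (hΓ x).2, α.β_psi_mul_ι_one]
        rfl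
      have h3 : (p : S) * (γ.one (x : G ⧸ H)⁻¹ : S) ∈ (α.restrict H).invariants :=
        (p * γ.one (x : G ⧸ H)⁻¹).2
      change (γ.act (x : G ⧸ H) p : S) * _ = α.act x (p : S)
      rw [h2, α.cosetAct_mul_one h x x rfl h3, act_mul, ← QuotientGroup.mk_inv, h1,
        ← act_mem α x (α.cosetAct h x⁻¹ 1), ← act_one_inv, ← act_mul,
        α.cosetAct_mul_one h x⁻¹ x⁻¹ rfl (one_mem _), act_one, act_one_inv, act_mem]
    · obtain ⟨g, rfl⟩ := QuotientGroup.mk_surjective q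
      change (γ.one (g : G ⧸ H) : S) ∈ _
      rw [h1]
      exact α.cosetAct_mem h g 1
  · intro hγ
    obtain ⟨n, ⟨e⟩⟩ := Finite.exists_equiv_fin H
    obtain _ | m := n
    · exact (e 1).elim0
    -- The swap arranges that the enumeration starts with 1.
    let h : Fin (m + 1) ≃ H := (Equiv.swap 0 (e 1)).trans e.symm
    have h0 : h 0 = 1 := by simp [h]
    refine ⟨α.globalization, m, h, h0, fun g => ⟨?_, fun x => ?_⟩⟩
    · rw [α.psi_mul_β_psi_mul_ι_one _ h h0, ← act_one]
      exact congrArg _ (hγ.val_act_eq_cosetAct α h g 1)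
    · rw [α.β_psi_mul_ι_one, ← hγ.val_act_eq_cosetAct α h g x, act_coe]

end UnitalPartialAction

/-! ### The product of partial Galois extensions -/

namespace PartialGaloisExtension

open UnitalPartialAction

section

variable {R : Type u} {G : Type v} [CommRing R]

theorem partialIso_of_act [Group G] {E E' : PartialGaloisExtension R G} (f : E.S ≃ₐ[R] E'.S)
    (hf : ∀ g s, f (E.α.act g s) = E'.α.act g (f s)) : PartialIso E E' := by
  have h1 : ∀ g, f (E.α.one g) = E'.α.one g := fun g => by
    rw [← act_one, hf, _root_.map_one, act_one]
  have h2 : ∀ g, ∀ x ∈ E.α.ideal g, f x ∈ E'.α.ideal g := fun g x hx => by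
    rw [mem_ideal, ← h1, ← map_mul, E.α.mem_ideal.1 hx]
  exact ⟨f, h2, fun g x => by rw [← act_coe, hf, ← act_coe]⟩

/-- The Galois property upgrades f(S_g) ⊆ S'_g to f(1_g) = 1'_g (`map_one_eq`), so f commutes with
the total maps. -/
theorem PartialIso.exists_act [Group G] [Finite G] {E E' : PartialGaloisExtension R G}
    (h : PartialIso E E') :
    ∃ f : E.S ≃ₐ[R] E'.S, ∀ g s, f (E.α.act g s) = E'.α.act g (f s) := by
  obtain ⟨f, hf, hf'⟩ := h
  have h1 : ∀ g, f (E.α.one g) * E'.α.one g = f (E.α.one g) := fun g =>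
    E'.α.mem_ideal.1 (hf g _ (E.α.mem_ideal.2 (E.α.one_idem g)))
  have h0 : ∀ g s, f (E.α.act g s) = E'.α.act g (f (s * E.α.one g⁻¹)) := fun g s => by
    rw [E.α.act_def, hf', ← E'.α.act_coe]
  have h2 : ∀ g s, f (E.α.act g s) = E'.α.act g (f s) * f (E.α.one g) := fun g s => by
    rw [h0, map_mul, E'.α.act_mul]
    congr 1
    rw [← E.α.act_one g, h0, one_mul]
  refine ⟨f, fun g s => ?_⟩
  rw [h2, E.isPartialGalois.map_one_eq E'.isPartialGalois f h1 h2 g, act_mem]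

variable [CommGroup G]

/-- `P` is, up to isomorphism, the product of `E` and `E'`. -/
def IsProduct (E E' P : PartialGaloisExtension R G) : Prop :=
  ∃ j : P.S →ₐ[R] E.S ⊗[R] E'.S, IsQuotientAlong mulMonoidHom j (E.α.tensor E'.α) P.α

/-- Since (a, b) and (ab, 1) differ by an element of δG, the quotient map becomes multiplication. -/
theorem toQuotientAntidiagonal_mul (x : G × G) :
    toQuotientAntidiagonal G (x.1 * x.2) = QuotientGroup.mk' (antidiagonal G) x := by
  refine QuotientGroup.eq.2 ?_
  change (1 : G)⁻¹ * x.2 = ((x.1 * x.2)⁻¹ * x.1)⁻¹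
  simp [mul_comm]

variable {E E' E'' P P' Q Q' : PartialGaloisExtension R G}

theorem IsProduct.partialIso (h : IsProduct E E' P) (h' : IsProduct E E' P') :
    PartialIso P P' := by
  obtain ⟨j, hj⟩ := h
  obtain ⟨j', hj'⟩ := h'
  obtain ⟨f, -, hf⟩ := hj.exists_algEquiv hj'
  exact partialIso_of_act f hf

theorem IsProduct.swap (h : IsProduct E E' P) : IsProduct E' E P := by
  obtain ⟨j, hj⟩ := h
  refine ⟨_, hj.transport MulEquiv.prodComm (Algebra.TensorProduct.comm R E.S E'.S)
    (fun x => mul_comm _ _) fun x w => ?_⟩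
  induction w using TensorProduct.induction_on with
  | zero => simp
  | add a b ha hb => simp only [map_add, ha, hb]
  | tmul a b =>
    rw [tensor_act_tmul, Algebra.TensorProduct.comm_tmul, Algebra.TensorProduct.comm_tmul,
      tensor_act_tmul]
    rfl

variable [Finite G]

theorem isProduct_of_isHarrisonProduct (h : IsHarrisonProduct E E' P) : IsProduct E E' P := by
  obtain ⟨γ, hγ, hγ', rfl⟩ := h
  rw [isQuotient_iff] at hγ
  exact ⟨_, hγ.comap _ toQuotientAntidiagonal_mul⟩

/-- Uniqueness is an actual equality: the invariant subalgebra is fixed, and the gluing conditions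
determine the action on it. -/
theorem existsUnique_isHarrisonProduct (E E' : PartialGaloisExtension R G) :
    ∃! P, IsHarrisonProduct E E' P := by
  obtain ⟨γ, hγ⟩ := (E.α.tensor E'.α).exists_isQuotientAlong_mk (H := antidiagonal G)
  have h : IsQuotientAlong mulMonoidHom _ (E.α.tensor E'.α)
      (γ.comap (toQuotientAntidiagonal G).toMonoidHom) := hγ.comap _ toQuotientAntidiagonal_mul
  refine ⟨_, ⟨γ, (isQuotient_iff ..).2 hγ,
    h.isPartialGalois (E.isPartialGalois.tensor E'.isPartialGalois), rfl⟩, ?_⟩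
  rintro _ ⟨γ', hγ', h', rfl⟩
  obtain rfl := hγ.eq_of_subalgebra ((isQuotient_iff ..).1 hγ')
  rfl

theorem IsProduct.congr (h : IsProduct E E' P) (hQ : PartialIso E Q) (hQ' : PartialIso E' Q') :
    IsProduct Q Q' P := by
  obtain ⟨j, hj⟩ := h
  obtain ⟨f, hf⟩ := hQ.exists_act
  obtain ⟨f', hf'⟩ := hQ'.exists_act
  refine ⟨_, hj.transport (MulEquiv.refl _) (Algebra.TensorProduct.congr f f') (fun _ => rfl)
    fun x w => ?_⟩
  induction w using TensorProduct.induction_on with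
  | zero => simp
  | add a b ha hb => simp only [map_add, ha, hb]
  | tmul a b =>
    rw [tensor_act_tmul, Algebra.TensorProduct.congr_apply, Algebra.TensorProduct.congr_apply,
      Algebra.TensorProduct.map_tmul, Algebra.TensorProduct.map_tmul, tensor_act_tmul]
    exact congrArg₂ (· ⊗ₜ[R] ·) (hf _ _) (hf' _ _)

/-- A product of three factors is a quotient of the triple tensor product. -/
theorem IsProduct.exists_isQuotientAlong (h : IsProduct E E' P) (h' : IsProduct P E'' Q) :
    ∃ j : Q.S →ₐ[R] (E.S ⊗[R] E'.S) ⊗[R] E''.S,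
      IsQuotientAlong (mulMonoidHom.comp (mulMonoidHom.prodMap (MonoidHom.id G))) j
        ((E.α.tensor E'.α).tensor E''.α) Q.α := by
  obtain ⟨j, hj⟩ := h
  obtain ⟨i, hi⟩ := h'
  exact ⟨_, (hj.tensor_right (E.isPartialGalois.tensor E'.isPartialGalois) E''.α).comp hi⟩

/-- Swapping the outer factors makes A(BC) a quotient of (B ⊗ C) ⊗ A. The quotient (AB)C of (A ⊗ B)
⊗ C is carried there by a cyclic permutation, which respects triple multiplication because G is
commutative; uniqueness of quotients concludes. -/
theorem IsProduct.assoc {A B C : PartialGaloisExtension R G} (hP : IsProduct A B P)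
    (hQ : IsProduct P C Q) (hP' : IsProduct B C P') (hQ' : IsProduct A P' Q') :
    PartialIso Q Q' := by
  obtain ⟨j, hj⟩ := hP.exists_isQuotientAlong hQ
  obtain ⟨i, hi⟩ := hP'.exists_isQuotientAlong hQ'.swap
  obtain ⟨f, -, hf⟩ := (hj.transport
    (φ' := mulMonoidHom.comp (mulMonoidHom.prodMap (MonoidHom.id G)))
    (ω' := (B.α.tensor C.α).tensor A.α)
    (MulEquiv.prodAssoc.trans MulEquiv.prodComm)
    ((Algebra.TensorProduct.assoc R R R A.S B.S C.S).trans
      (Algebra.TensorProduct.comm R A.S (B.S ⊗[R] C.S)))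
    (fun x => (mul_comm _ _).trans (mul_assoc x.1.1 x.1.2 x.2).symm) fun x w => by
      induction w using TensorProduct.induction_on with
      | zero => simp
      | add a b ha hb => simp only [map_add, ha, hb]
      | tmul t c =>
        induction t using TensorProduct.induction_on with
        | zero => simp
        | add a b ha hb => simp only [TensorProduct.add_tmul, map_add, ha, hb]
        | tmul a b =>
          rw [tensor_act_tmul, tensor_act_tmul]
          exact (congrArg (· ⊗ₜ[R] A.α.act x.1.1 a)
            (tensor_act_tmul B.α C.α (x.1.2, x.2) b c)).symm.trans
            (tensor_act_tmul (B.α.tensor C.α) A.α ((x.1.2, x.2), x.1.1) (b ⊗ₜ c) a).symm).exists_algEquiv hi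
  exact partialIso_of_act f hf

/-- The product of partial Galois extensions. -/
noncomputable def prod (E E' : PartialGaloisExtension R G) : PartialGaloisExtension R G :=
  (existsUnique_isHarrisonProduct E E').choose

theorem isHarrisonProduct_prod (E E' : PartialGaloisExtension R G) :
    IsHarrisonProduct E E' (E.prod E') :=
  (existsUnique_isHarrisonProduct E E').choose_spec.1

theorem isProduct_prod (E E' : PartialGaloisExtension R G) : IsProduct E E' (E.prod E') :=
  isProduct_of_isHarrisonProduct (isHarrisonProduct_prod E E')

end

end PartialGaloisExtension

/-- The semigroup of partial isomorphism classes of partial Galois extensions. -/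
noncomputable abbrev HPar.commSemigroup (R : Type u) [CommRing R] (G : Type v) [CommGroup G]
    [Finite G] : CommSemigroup (HPar R G) where
  mul := Quotient.map₂ PartialGaloisExtension.prod fun E Q hQ E' Q' hQ' =>
    ((PartialGaloisExtension.isProduct_prod E E').congr hQ hQ').partialIso
      (PartialGaloisExtension.isProduct_prod Q Q')
  mul_assoc a b c := by
    induction a using Quotient.inductionOn
    induction b using Quotient.inductionOn
    induction c using Quotient.inductionOn
    exact Quotient.sound ((PartialGaloisExtension.isProduct_prod _ _).assoc
      (PartialGaloisExtension.isProduct_prod _ _) (PartialGaloisExtension.isProduct_prod _ _)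
      (PartialGaloisExtension.isProduct_prod _ _))
  mul_comm a b := by
    induction a using Quotient.inductionOn
    induction b using Quotient.inductionOn
    exact Quotient.sound ((PartialGaloisExtension.isProduct_prod _ _).swap.partialIso
      (PartialGaloisExtension.isProduct_prod _ _))

/-- The product `[S, α] * [S', α'] = [(S ⊗ S')^{δG}, (α ⊗ α')_{(G × G)/δG}]` is defined on
representatives, independent of their choice, and makes `H_par(G, R)` a commutative semigroup. -/
theorem proposition5 {R : Type u} [CommRing R] {G : Type v} [CommGroup G] [Finite G] :
    (∀ E E' : PartialGaloisExtension R G, ∃! P, IsHarrisonProduct E E' P) ∧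
    ∃ _ : CommSemigroup (HPar R G), ∀ E E' P : PartialGaloisExtension R G,
      IsHarrisonProduct E E' P → HPar.mk E * HPar.mk E' = HPar.mk P := by
  refine ⟨PartialGaloisExtension.existsUnique_isHarrisonProduct, HPar.commSemigroup R G,
    fun E E' P hP => ?_⟩
  rw [(PartialGaloisExtension.existsUnique_isHarrisonProduct E E').unique hP
    (PartialGaloisExtension.isHarrisonProduct_prod E E')]
  rfl
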